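/- For $V:\mathbb{R}^\nu\to\mathbb{R}$, let $-\Delta+V$ denote the operator in the complex space $L^2(\mathbb{R}^\nu)$ associated with the sesquilinear form $(\varphi,\psi)\mapsto\int_{\mathbb{R}^\nu}\overline{\nabla\varphi}\cdot\nabla\psi\,dx+\int_{\mathbb{R}^\nu}V\,\overline{\varphi}\,\psi\,dx$ with form domain $H^1(\mathbb{R}^\nu)$. **Theorem 2.2.** Let $\nu\ge 1$ be an integer. There is a sequence of measurable radial potentials $V_n:\mathbb{R}^\nu\to\mathbb{R}$, $n=1,2,3,\dots$, such that for every $n\geq 1$ the number $1$ is an eigenvalue of $-\Delta+V_n$ in $L^2(\mathbb{R}^\nu)$, and $$|V_n(x)|\le\frac{C}{n+|x|}\qquad\text{for all } x\in\mathbb{R}^\nu,\ n\ge1,$$ with a constant $C>0$ independent of $n$ and $x$. Moreover, for every $p\in(\nu,\infty]$, each $V_n$ belongs to $L^p(\mathbb{R}^\nu)$ and $\|V_n\|_{L^p(\mathbb{R}^\nu)}\to0$ as $n\to\infty$. Consequently, for no $\gamma>\nu/2$ is there a constant $C_{\gamma,\nu}$ such that $$|E|^\gamma\le C_{\gamma,\nu}\int_{\mathbb{R}^\nu}|V(x)|^{\gamma+\nu/2}\,dx$$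 holds for all real-valued radial $V\in L^{\gamma+\nu/2}(\mathbb{R}^\nu)$ and all positive eigenvalues $E$ of $-\Delta+V$. -/

import Mathlib

open MeasureTheory Filter Topology
open scoped ENNReal SchwartzMap LineDeriv

/-- Complex-valued square-integrable functions on `ℝ^ν`, with Lebesgue measure. -/
abbrev L2Space (ν : ℕ) : Type := Lp ℂ 2 (volume : Measure (EuclideanSpace ℝ (Fin ν)))

/-- The functions `G i`, all in `L²`, are the weak (distributional) partial derivatives of `u ∈ L²`.
Hence `u ∈ H¹(ℝ^ν)` if and only if `∃ G, HasWeakGradient u G`. -/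
def HasWeakGradient {ν : ℕ} (u : L2Space ν) (G : Fin ν → L2Space ν) : Prop :=
  ∀ i : Fin ν,
    ∂_{EuclideanSpace.single i (1 : ℝ)} (u : 𝓢'(EuclideanSpace ℝ (Fin ν), ℂ)) =
      (G i : 𝓢'(EuclideanSpace ℝ (Fin ν), ℂ))

theorem HasWeakGradient.zero {ν : ℕ} : HasWeakGradient (0 : L2Space ν) 0 := by
  intro i
  have h : ((0 : L2Space ν) : 𝓢'(EuclideanSpace ℝ (Fin ν), ℂ)) = 0 :=
    map_zero (Lp.toTemperedDistributionCLM ℂ volume 2)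
  simp only [Pi.zero_apply, h]
  exact map_zero (LineDeriv.lineDerivOpCLM ℂ 𝓢'(EuclideanSpace ℝ (Fin ν), ℂ)
    (EuclideanSpace.single i (1 : ℝ)))

theorem HasWeakGradient.add {ν : ℕ} {u v : L2Space ν} {G H : Fin ν → L2Space ν}
    (hu : HasWeakGradient u G) (hv : HasWeakGradient v H) :
    HasWeakGradient (u + v) (G + H) := by
  intro i
  have h : ∀ a b : L2Space ν, ((a + b : L2Space ν) : 𝓢'(EuclideanSpace ℝ (Fin ν), ℂ)) = a + b :=
    map_add (Lp.toTemperedDistributionCLM ℂ volume 2)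
  rw [Pi.add_apply, h, h, LineDeriv.lineDerivOp_add, hu i, hv i]

theorem HasWeakGradient.smul {ν : ℕ} {u : L2Space ν} {G : Fin ν → L2Space ν} (c : ℂ)
    (hu : HasWeakGradient u G) : HasWeakGradient (c • u) (c • G) := by
  intro i
  have h : ∀ a : L2Space ν, ((c • a : L2Space ν) : 𝓢'(EuclideanSpace ℝ (Fin ν), ℂ)) =
      c • (a : 𝓢'(EuclideanSpace ℝ (Fin ν), ℂ)) :=
    map_smul (Lp.toTemperedDistributionCLM ℂ volume 2) c
  rw [Pi.smul_apply, h, h, LineDeriv.lineDerivOp_smul, hu i]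

/-- The graph of the operator `-Δ + V` in `L²(ℝ^ν)` associated with the sesquilinear form
`(φ, ψ) ↦ ∫ conj (∇φ) · ∇ψ + ∫ conj φ * V * ψ` with form domain `H¹(ℝ^ν)`: the pair `(ψ, f)`
belongs to it if `ψ ∈ H¹`, and the form at `(φ, ψ)` equals `⟨φ, f⟩` for every `φ ∈ H¹`. -/
noncomputable def schrodingerGraph {ν : ℕ} (V : EuclideanSpace ℝ (Fin ν) → ℂ) :
    Submodule ℂ (L2Space ν × L2Space ν) where
  carrier := {p | ∃ G : Fin ν → L2Space ν, HasWeakGradient p.1 G ∧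
    ∀ (φ : L2Space ν) (H : Fin ν → L2Space ν), HasWeakGradient φ H →
      Integrable (fun x => star (φ x) * (V x * p.1 x)) volume ∧
      (∑ i, inner ℂ (H i) (G i)) + ∫ x, star (φ x) * (V x * p.1 x) = inner ℂ φ p.2}
  zero_mem' := by
    refine ⟨0, HasWeakGradient.zero, fun φ H _ => ?_⟩
    have h : (fun x => star (φ x) * (V x * (0 : L2Space ν) x)) =ᵐ[volume] fun _ => (0 : ℂ) := by
      filter_upwards with x
      simp
    refine ⟨(integrable_congr h).2 (integrable_zero _ _ _), ?_⟩
    simp only [Prod.fst_zero, Prod.snd_zero, inner_zero_right, Pi.zero_apply,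
      Finset.sum_const_zero, zero_add]
    rw [integral_congr_ae h, integral_zero]
  add_mem' := by
    rintro ⟨u, f⟩ ⟨v, g⟩ ⟨G, hG, hu⟩ ⟨K, hK, hv⟩
    refine ⟨G + K, hG.add hK, fun φ H hφ => ?_⟩
    obtain ⟨hu1, hu2⟩ := hu φ H hφ
    obtain ⟨hv1, hv2⟩ := hv φ H hφ
    have h : (fun x => star (φ x) * (V x * (u + v : L2Space ν) x)) =ᵐ[volume]
        (fun x => star (φ x) * (V x * u x)) + fun x => star (φ x) * (V x * v x) := by
      filter_upwards [Lp.coeFn_add u v] with x hx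
      simp only [hx, Pi.add_apply]
      ring
    refine ⟨(integrable_congr h).2 (hu1.add hv1), ?_⟩
    simp only [Prod.mk_add_mk, Pi.add_apply, inner_add_right, Finset.sum_add_distrib]
    rw [integral_congr_ae h, integral_add' hu1 hv1, ← hu2, ← hv2]
    ring
  smul_mem' := by
    rintro c ⟨u, f⟩ ⟨G, hG, hu⟩
    refine ⟨c • G, hG.smul c, fun φ H hφ => ?_⟩
    obtain ⟨hu1, hu2⟩ := hu φ H hφ
    have h : (fun x => star (φ x) * (V x * (c • u : L2Space ν) x)) =ᵐ[volume]
        fun x => c * (star (φ x) * (V x * u x)) := by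
      filter_upwards [Lp.coeFn_smul c u] with x hx
      simp only [hx, Pi.smul_apply, smul_eq_mul]
      ring
    refine ⟨(integrable_congr h).2 (hu1.const_mul c), ?_⟩
    simp only [Prod.smul_mk, Pi.smul_apply, inner_smul_right]
    rw [integral_congr_ae h, integral_const_mul, ← hu2, ← Finset.mul_sum]
    ring

/-- The Schrödinger operator `-Δ + V` in `L²(ℝ^ν)`, defined through its sesquilinear form. -/
noncomputable def schrodingerOperator {ν : ℕ} (V : EuclideanSpace ℝ (Fin ν) → ℂ) :
    L2Space ν →ₗ.[ℂ] L2Space ν :=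
  (schrodingerGraph V).toLinearPMap

theorem hasWeakGradient_schwartz {ν : ℕ} (φ : 𝓢(EuclideanSpace ℝ (Fin ν), ℂ)) :
    HasWeakGradient (φ.toLp 2)
      (fun i => (∂_{EuclideanSpace.single i (1 : ℝ)} φ : 𝓢(EuclideanSpace ℝ (Fin ν), ℂ)).toLp 2) := by
  intro i
  rw [Lp.toTemperedDistribution_toLp_eq, Lp.toTemperedDistribution_toLp_eq,
    TemperedDistribution.lineDerivOp_toTemperedDistributionCLM_eq]

/-- The graph is single-valued, so it really is the graph of `schrodingerOperator V`. -/
theorem graph_schrodingerOperator {ν : ℕ} (V : EuclideanSpace ℝ (Fin ν) → ℂ) :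
    (schrodingerOperator V).graph = schrodingerGraph V := by
  refine Submodule.toLinearPMap_graph_eq _ ?_
  rintro ⟨u, f⟩ ⟨G, hG, h⟩ hu
  obtain rfl : u = 0 := hu
  have hG0 : ∀ i, G i = 0 := by
    intro i
    have hi := (HasWeakGradient.zero i).symm.trans (hG i)
    have hk : G i ∈ (Lp.toTemperedDistributionCLM ℂ
        (volume : Measure (EuclideanSpace ℝ (Fin ν))) 2).ker := by
      rw [LinearMap.mem_ker]
      exact hi.symm.trans (map_zero (Lp.toTemperedDistributionCLM ℂ volume 2))
    rwa [Lp.ker_toTemperedDistributionCLM_eq_bot, Submodule.mem_bot] at hk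
  have h0 : ∀ φ : 𝓢(EuclideanSpace ℝ (Fin ν), ℂ), inner ℂ (φ.toLp 2) f = 0 := by
    intro φ
    rw [← (h _ _ (hasWeakGradient_schwartz φ)).2]
    have hz : (fun x => star ((φ.toLp 2) x) * (V x * (0 : L2Space ν) x)) =ᵐ[volume]
        fun _ => (0 : ℂ) := by
      filter_upwards with x
      simp
    rw [integral_congr_ae hz]
    simp [hG0]
  have hd : DenseRange (SchwartzMap.toLpCLM ℝ ℂ 2
      (volume : Measure (EuclideanSpace ℝ (Fin ν)))) := SchwartzMap.denseRange_toLpCLM (by simp)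
  exact hd.eq_zero_of_inner_right ℂ (fun φ => h0 φ)

/-- `E` is an eigenvalue of the (unbounded) operator `T`. -/
def IsEigenvalue {X : Type*} [AddCommGroup X] [Module ℂ X] (T : X →ₗ.[ℂ] X) (E : ℂ) : Prop :=
  ∃ ψ : T.domain, (ψ : X) ≠ 0 ∧ T ψ = E • (ψ : X)

/-- A function on `ℝ^ν` is radial if its value at `x` depends on `|x|` only. -/
def IsRadial {ν : ℕ} (V : EuclideanSpace ℝ (Fin ν) → ℝ) : Prop :=
  ∀ x y, ‖x‖ = ‖y‖ → V x = V y

/-! The construction is that of von Neumann and Wigner. Put m = ν - 1, let φ be the radial solution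
of -Δφ = φ with φ(0) = 1, and let g(r) = ∫₀^r ρ^m φ(ρ)² dρ be its radial mass. For t = n set u = φ w
with w = 1 / (t² + g²), and V = (Δu + u) / u. Since w' = -2 g r^m φ² w² carries a factor φ², the
division by φ leaves an expression regular also at the zeros of φ; `potentialProfile` is this
expression and `profile_equation` checks it.

Decay rests on two facts about φ. The energy r^m (φ² + φ'²) lies between positive constants for
large r (`exists_radialEnergy_bounds`), so φ and φ' are O(r^(-m/2)). Lommel's closed form for g then
makes g grow at least linearly (`exists_le_radialMass`), so w = O((t + r)⁻²) and g w ≤ √w = O((t +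
r)⁻¹), uniformly in t ≥ 1. Every term of V has a factor g w or w, hence |V| ≤ C / (t + r), and u is
square integrable with its derivatives.

All radial functions are written in s = r², which makes them differentiable at the origin and
reduces the identities to polynomial algebra. The L^p claims follow from the pointwise bound. The
potentials with E = 1 refute the inequality: its left side stays 1 while its right side tends to 0.
-/

/-! ### Weak derivatives and integration by parts in H¹ -/

section WeakDerivative

open FourierTransform

variable {ν : ℕ}

local notation "E" => EuclideanSpace ℝ (Fin ν)

/-- A function in `L²` whose classical directional derivative exists everywhere and is in `L²`
has that derivative as its distributional derivative. -/
theorem lineDerivOp_toLp_of_hasLineDerivAt {F F' : E → ℂ} (hF : MemLp F 2 volume)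
    (hF' : MemLp F' 2 volume) (v : E) (h : ∀ x, HasLineDerivAt ℝ F (F' x) x v) :
    ∂_{v} ((hF.toLp F : L2Space ν) : 𝓢'(E, ℂ)) = ((hF'.toLp F' : L2Space ν) : 𝓢'(E, ℂ)) := by
  ext η
  rw [TemperedDistribution.lineDerivOp_apply_apply, Lp.toTemperedDistribution_apply,
    Lp.toTemperedDistribution_apply]
  have h1 : ∫ x, (-∂_{v} η : 𝓢(E, ℂ)) x • (hF.toLp F : L2Space ν) x =
      - ∫ x, (∂_{v} η : 𝓢(E, ℂ)) x * F x := by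
    rw [← integral_neg]
    refine integral_congr_ae ?_
    filter_upwards [hF.coeFn_toLp] with x hx
    rw [hx]
    simp
  have h2 : ∫ x, η x • (hF'.toLp F' : L2Space ν) x = ∫ x, η x * F' x := by
    refine integral_congr_ae ?_
    filter_upwards [hF'.coeFn_toLp] with x hx
    rw [hx]
    simp
  rw [h1, h2]
  have hη : ∀ ζ : 𝓢(E, ℂ), MemLp ζ 2 volume := fun ζ => ζ.memLp 2
  have key := integral_bilinear_hasLineDerivAt_right_eq_neg_left_of_integrable
    (μ := (volume : Measure E)) (f := fun x => η x) (f' := fun x => (∂_{v} η : 𝓢(E, ℂ)) x)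
    (g := F) (g' := F') (v := v) (B := ContinuousLinearMap.mul ℝ ℂ)
    ((hη _).integrable_mul hF) ((hη _).integrable_mul hF') ((hη _).integrable_mul hF)
    (fun x _ => by
      rw [SchwartzMap.lineDerivOp_apply_eq_fderiv]
      exact (η.differentiableAt.hasFDerivAt).hasLineDerivAt v)
    (fun x _ => h x)
  simpa using key.symm

/-- The Fourier transform turns a weak derivative into a multiplication. -/
theorem fourier_ae_eq_of_lineDerivOp_eq {u U : L2Space ν} (v : E)
    (h : ∂_{v} (u : 𝓢'(E, ℂ)) = (U : 𝓢'(E, ℂ))) :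
    (𝓕 U : L2Space ν) =ᵐ[volume]
      fun x => (2 * Real.pi * Complex.I) * (inner ℝ x v : ℝ) * (𝓕 u : L2Space ν) x := by
  have hF : (2 * Real.pi * Complex.I) • TemperedDistribution.smulLeftCLM ℂ
      (fun x => ((inner ℝ x v : ℝ) : ℂ)) ((𝓕 u : L2Space ν) : 𝓢'(E, ℂ)) =
      ((𝓕 U : L2Space ν) : 𝓢'(E, ℂ)) := by
    rw [← Lp.fourier_toTemperedDistribution_eq, ← Lp.fourier_toTemperedDistribution_eq, ← h,
      TemperedDistribution.fourier_lineDerivOp_eq]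
  have hli : ∀ w : L2Space ν, LocallyIntegrable w volume :=
    fun w => (Lp.memLp w).locallyIntegrable (by norm_num)
  have hc : Continuous fun x : E => (2 * Real.pi * Complex.I) * ((inner ℝ x v : ℝ) : ℂ) := by
    fun_prop
  refine ae_eq_of_integral_contDiff_smul_eq (hli _)
    ?_ ?_
  · have := (locallyIntegrableOn_univ.2 (hli (𝓕 u))).continuousOn_mul
      hc.continuousOn isOpen_univ.isLocallyClosed
    exact locallyIntegrableOn_univ.1 this
  · intro g hg hgc
    have hg₁ : HasCompactSupport (Complex.ofRealCLM ∘ g) := hgc.comp_left rfl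
    have hg₂ : ContDiff ℝ ((⊤ : ℕ∞) : WithTop ℕ∞) (Complex.ofRealCLM ∘ g) :=
      Complex.ofRealCLM.contDiff.comp hg
    have hη : ∀ x, hg₁.toSchwartzMap hg₂ x = (g x : ℂ) := fun x => by simp
    have := congrArg (fun T : 𝓢'(E, ℂ) => T (hg₁.toSchwartzMap hg₂)) hF
    have ht : (fun x : E => ((inner ℝ x v : ℝ) : ℂ)).HasTemperateGrowth := by fun_prop
    change (2 * Real.pi * Complex.I) • Lp.toTemperedDistribution (𝓕 u : L2Space ν)
      (SchwartzMap.smulLeftCLM ℂ (fun x => ((inner ℝ x v : ℝ) : ℂ)) (hg₁.toSchwartzMap hg₂)) = _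
      at this
    rw [Lp.toTemperedDistribution_apply, Lp.toTemperedDistribution_apply,
      ← integral_smul] at this
    simp only [SchwartzMap.smulLeftCLM_apply_apply ht, hη] at this
    calc _ = ∫ x, (g x : ℂ) • (𝓕 U : L2Space ν) x := by simp
      _ = _ := this.symm
      _ = _ := integral_congr_ae (Eventually.of_forall fun x => by
        simp only [smul_eq_mul, Complex.real_smul]; ring)

/-- Integration by parts in `H¹`. -/
theorem inner_eq_neg_inner_of_lineDerivOp_eq {u U w U' : L2Space ν} (v : E)
    (hu : ∂_{v} (u : 𝓢'(E, ℂ)) = (U : 𝓢'(E, ℂ))) (hw : ∂_{v} (w : 𝓢'(E, ℂ)) = (U' : 𝓢'(E, ℂ))) :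
    inner ℂ U w = - inner ℂ u U' := by
  -- By Parseval both sides become integrals over frequencies; the multiplier 2πi⟨x, v⟩ is purely
  -- imaginary, so moving it across the conjugation produces the sign.
  rw [← Lp.inner_fourier_eq U w, ← Lp.inner_fourier_eq u U', L2.inner_def, L2.inner_def,
    ← integral_neg]
  refine integral_congr_ae ?_
  filter_upwards [fourier_ae_eq_of_lineDerivOp_eq v hu, fourier_ae_eq_of_lineDerivOp_eq v hw]
    with x h1 h2
  rw [h1, h2]
  simp only [RCLike.inner_apply, map_mul, Complex.conj_I, Complex.conj_ofReal, map_ofNat]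
  ring

end WeakDerivative

/-! ### The radial solution of -Δφ = φ as a power series in r² -/

section BesselSeries

open scoped Nat

/-- A power series whose coefficients are at most `1 / k!` can be differentiated termwise. -/
theorem hasDerivAt_tsum_mul_pow {c : ℕ → ℝ} (hc : ∀ k, |c k| ≤ 1 / k !) (s : ℝ) :
    HasDerivAt (fun s : ℝ => ∑' k, c k * s ^ k) (∑' k, (k + 1) * c (k + 1) * s ^ k) s := by
  set R : ℝ := |s| + 1 with hR
  have hR0 : 0 ≤ R := by positivity
  have hsucc : ∀ k : ℕ, ((k + 1 : ℕ) : ℝ) * (1 / ((k + 1)! : ℕ)) = 1 / (k ! : ℕ) := by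
    intro k
    have h1 : ((k ! : ℕ) : ℝ) ≠ 0 := by positivity
    have h2 : ((k : ℝ) + 1) ≠ 0 := by positivity
    rw [Nat.factorial_succ]
    push_cast
    field_simp
  have hu : Summable fun k : ℕ => (k : ℝ) * (1 / (k ! : ℕ)) * R ^ (k - 1) := by
    refine (summable_nat_add_iff 1).1 ?_
    refine (Real.summable_pow_div_factorial R).congr fun k => ?_
    rw [hsucc, Nat.add_sub_cancel]
    ring
  have hg : ∀ k : ℕ, ∀ y ∈ Metric.ball (0 : ℝ) R,
      HasDerivAt (fun y : ℝ => c k * y ^ k) (c k * ((k : ℝ) * y ^ (k - 1))) y :=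
    fun k y _ => (hasDerivAt_pow k y).const_mul (c k)
  have hg' : ∀ k : ℕ, ∀ y ∈ Metric.ball (0 : ℝ) R,
      ‖c k * ((k : ℝ) * y ^ (k - 1))‖ ≤ (k : ℝ) * (1 / (k ! : ℕ)) * R ^ (k - 1) := by
    intro k y hy
    rw [mem_ball_zero_iff, Real.norm_eq_abs] at hy
    rw [Real.norm_eq_abs, abs_mul, abs_mul, abs_pow, Nat.abs_cast]
    calc |c k| * (k * |y| ^ (k - 1)) ≤ (1 / (k ! : ℕ)) * (k * R ^ (k - 1)) := by
          gcongr
          exact hc k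
      _ = _ := by ring
  have h0 : Summable fun k : ℕ => c k * (0 : ℝ) ^ k :=
    summable_of_ne_finset_zero (s := {0}) fun k hk => by
      rw [zero_pow (by simpa using hk), mul_zero]
  have hs : s ∈ Metric.ball (0 : ℝ) R := by
    rw [mem_ball_zero_iff, Real.norm_eq_abs]
    linarith
  have key := hasDerivAt_tsum_of_isPreconnected hu Metric.isOpen_ball
    (convex_ball (0 : ℝ) R).isPreconnected hg hg' (Metric.mem_ball_self (by positivity)) h0 hs
  have hsum : Summable fun k : ℕ => c k * ((k : ℝ) * s ^ (k - 1)) :=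
    Summable.of_norm_bounded hu fun k => hg' k s hs
  have heq : ∑' k : ℕ, ((k : ℝ) + 1) * c (k + 1) * s ^ k =
      ∑' k : ℕ, c k * ((k : ℝ) * s ^ (k - 1)) := by
    rw [hsum.tsum_eq_zero_add]
    simp only [Nat.cast_zero, zero_mul, mul_zero, zero_add, Nat.add_sub_cancel, Nat.cast_add,
      Nat.cast_one]
    exact tsum_congr fun k => by ring
  rw [heq]
  exact key

theorem summable_mul_pow_of_le_inv_factorial {c : ℕ → ℝ} (hc : ∀ k, |c k| ≤ 1 / k !) (s : ℝ) :
    Summable fun k => c k * s ^ k := by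
  refine Summable.of_norm_bounded (Real.summable_pow_div_factorial |s|) fun k => ?_
  rw [Real.norm_eq_abs, abs_mul, abs_pow]
  calc |c k| * |s| ^ k ≤ (1 / (k ! : ℕ)) * |s| ^ k := by
        gcongr
        exact hc k
    _ = _ := by ring

/-- Taylor coefficients in the variable `|x|²` of the radial solution of `-Δφ = φ` on
`ℝ^(m+1)`. -/
noncomputable def besselCoeff (m : ℕ) : ℕ → ℝ
  | 0 => 1
  | k + 1 => -besselCoeff m k / ((k + 1) * (4 * k + 2 * (m + 1)))

/-- Taylor coefficients of the `j`-th derivative of the series with coefficients `besselCoeff`. -/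
noncomputable def besselCoeffDeriv (m : ℕ) : ℕ → ℕ → ℝ
  | 0, k => besselCoeff m k
  | j + 1, k => (k + 1) * besselCoeffDeriv m j (k + 1)

theorem abs_besselCoeff_le (m k : ℕ) : |besselCoeff m k| ≤ 1 / k ! := by
  induction k with
  | zero => simp [besselCoeff]
  | succ k ih =>
    have h1 : (0 : ℝ) < k ! := by positivity
    have h2 : (1 : ℝ) ≤ 4 * k + 2 * (m + 1) := by
      have : (0 : ℝ) ≤ k := by positivity
      have : (0 : ℝ) ≤ m := by positivity
      linarith
    have h3 : (0 : ℝ) < (k + 1) * (4 * k + 2 * (m + 1)) := by positivity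
    rw [besselCoeff, abs_div, abs_neg, abs_of_pos h3, Nat.factorial_succ]
    push_cast
    calc |besselCoeff m k| / ((k + 1) * (4 * k + 2 * (m + 1)))
        ≤ (1 / (k ! : ℕ)) / ((k + 1) * 1) := by gcongr
      _ = _ := by field_simp

/-- The bound 1 / k! reproduces itself under termwise differentiation, the factor k + 1 being
absorbed by (k + 1)!. One differentiation lemma thus serves every j. -/
theorem abs_besselCoeffDeriv_le (m j k : ℕ) : |besselCoeffDeriv m j k| ≤ 1 / k ! := by
  induction j generalizing k with
  | zero => exact abs_besselCoeff_le m k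
  | succ j ih =>
    have h1 : (0 : ℝ) < k ! := by positivity
    have h2 : (0 : ℝ) < (k : ℝ) + 1 := by positivity
    rw [besselCoeffDeriv, abs_mul, abs_of_pos h2]
    calc ((k : ℝ) + 1) * |besselCoeffDeriv m j (k + 1)|
        ≤ ((k : ℝ) + 1) * (1 / ((k + 1)! : ℕ)) := by
          gcongr
          exact ih (k + 1)
      _ = _ := by
          rw [Nat.factorial_succ]
          push_cast
          field_simp

/-- The `j`-th derivative of the function `Φ` such that `x ↦ Φ (|x|²)` is the radial solution of
`-Δφ = φ` on `ℝ^(m+1)` with value `1` at the origin. -/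
noncomputable def besselSeries (m j : ℕ) (s : ℝ) : ℝ := ∑' k, besselCoeffDeriv m j k * s ^ k

theorem hasDerivAt_besselSeries (m j : ℕ) (s : ℝ) :
    HasDerivAt (besselSeries m j) (besselSeries m (j + 1) s) s :=
  hasDerivAt_tsum_mul_pow (abs_besselCoeffDeriv_le m j) s

theorem continuous_besselSeries (m j : ℕ) : Continuous (besselSeries m j) :=
  continuous_iff_continuousAt.2 fun s => (hasDerivAt_besselSeries m j s).continuousAt

theorem besselSeries_zero (m : ℕ) : besselSeries m 0 0 = 1 := by
  rw [besselSeries, tsum_eq_single 0 fun k hk => by rw [zero_pow hk, mul_zero]]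
  simp [besselCoeffDeriv, besselCoeff]

/-- This is φ'' + (m / r) φ' + φ = 0 in the variable s = r²; comparing coefficients gives the
recursion that defines `besselCoeff`. -/
theorem besselSeries_ode (m : ℕ) (s : ℝ) :
    4 * s * besselSeries m 2 s + 2 * (m + 1) * besselSeries m 1 s + besselSeries m 0 s = 0 := by
  have hs : ∀ j, Summable fun k => besselCoeffDeriv m j k * s ^ k := fun j =>
    summable_mul_pow_of_le_inv_factorial (abs_besselCoeffDeriv_le m j) s
  have hsum : Summable fun k : ℕ => k * besselCoeffDeriv m 1 k * s ^ k := by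
    refine (summable_nat_add_iff 1).1 (((hs 2).mul_left s).congr fun k => ?_)
    rw [besselCoeffDeriv]
    push_cast
    ring
  have h2 : s * besselSeries m 2 s = ∑' k : ℕ, k * besselCoeffDeriv m 1 k * s ^ k := by
    rw [hsum.tsum_eq_zero_add, besselSeries, ← tsum_mul_left]
    simp only [Nat.cast_zero, zero_mul, zero_add]
    refine tsum_congr fun k => ?_
    rw [besselCoeffDeriv]
    push_cast
    ring
  rw [mul_assoc, h2, besselSeries, besselSeries, ← tsum_mul_left, ← tsum_mul_left,
    ← (hsum.mul_left 4).tsum_add ((hs 1).mul_left _),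
    ← ((hsum.mul_left 4).add ((hs 1).mul_left _)).tsum_add (hs 0)]
  refine (tsum_congr fun k => ?_).trans tsum_zero
  have h3 : (0 : ℝ) < (k + 1) * (4 * k + 2 * (m + 1)) := by positivity
  simp only [besselCoeffDeriv, besselCoeff]
  field_simp
  ring

end BesselSeries

/-! ### Radial mass and energy -/

section RadialSolution

variable (m : ℕ)

local notation "Φ₀" => besselSeries m 0
local notation "Φ₁" => besselSeries m 1
local notation "Φ₂" => besselSeries m 2

/-- The even function `h` with `∫ t in 0..r, t ^ m * Φ (t²) ^ 2 = r ^ (m + 1) * h (r²)`, in the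
closed form given by Lommel's integral. -/
noncomputable def lommel (s : ℝ) : ℝ :=
  (4 * s * Φ₁ s ^ 2 + Φ₀ s ^ 2 + 2 * (m - 1) * (Φ₀ s * Φ₁ s)) / 2

/-- The derivative of `lommel`. -/
noncomputable def lommelDeriv (s : ℝ) : ℝ :=
  (4 * Φ₁ s ^ 2 + 8 * s * (Φ₁ s * Φ₂ s) + 2 * (Φ₀ s * Φ₁ s) +
    2 * (m - 1) * (Φ₁ s ^ 2 + Φ₀ s * Φ₂ s)) / 2

theorem hasDerivAt_lommel (s : ℝ) : HasDerivAt (lommel m) (lommelDeriv m s) s := by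
  have h0 := hasDerivAt_besselSeries m 0 s
  have h1 := hasDerivAt_besselSeries m 1 s
  have h := (((((hasDerivAt_id s).const_mul 4).mul (h1.pow 2)).add (h0.pow 2)).add
    ((h0.mul h1).const_mul (2 * ((m : ℝ) - 1)))).div_const 2
  refine h.congr_deriv ?_
  simp only [lommelDeriv, id, Nat.cast_ofNat, Pi.pow_apply, pow_one, Nat.add_one_sub_one]
  ring

theorem continuous_lommel : Continuous (lommel m) :=
  continuous_iff_continuousAt.2 fun s => (hasDerivAt_lommel m s).continuousAt

theorem continuous_lommelDeriv : Continuous (lommelDeriv m) := by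
  have h0 := continuous_besselSeries m 0
  have h1 := continuous_besselSeries m 1
  have h2 := continuous_besselSeries m 2
  unfold lommelDeriv
  fun_prop

/-- After division by r^m, this is the statement that the derivative of r^(m+1) h(r²) is r^m φ². The
second derivative Φ₂ enters only through s Φ₂, which the differential equation eliminates. -/
theorem lommel_add_lommelDeriv (s : ℝ) :
    (m + 1) * lommel m s + 2 * s * lommelDeriv m s = Φ₀ s ^ 2 := by
  simp only [lommel, lommelDeriv]
  linear_combination (2 * s * Φ₁ s + ((m : ℝ) - 1) / 2 * Φ₀ s) * besselSeries_ode m s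

/-- The integral `∫ t in 0..r, t ^ m * Φ (t²) ^ 2`. -/
noncomputable def radialMass (r : ℝ) : ℝ := r ^ (m + 1) * lommel m (r ^ 2)

theorem hasDerivAt_radialMass (r : ℝ) :
    HasDerivAt (radialMass m) (r ^ m * Φ₀ (r ^ 2) ^ 2) r := by
  have h := (hasDerivAt_pow (m + 1) r).mul
    ((hasDerivAt_lommel m (r ^ 2)).comp r (hasDerivAt_pow 2 r))
  refine h.congr_deriv ?_
  rw [← lommel_add_lommelDeriv]
  simp only [Function.comp_apply, Nat.cast_add, Nat.cast_one, Nat.cast_ofNat, Nat.add_sub_cancel]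
  ring

theorem monotoneOn_radialMass : MonotoneOn (radialMass m) (Set.Ici 0) := by
  refine monotoneOn_of_deriv_nonneg (convex_Ici 0)
    (fun r _ => (hasDerivAt_radialMass m r).continuousAt.continuousWithinAt)
    (fun r _ => (hasDerivAt_radialMass m r).differentiableAt.differentiableWithinAt) fun r hr => ?_
  rw [interior_Ici] at hr
  rw [(hasDerivAt_radialMass m r).deriv]
  have : (0 : ℝ) < r := hr
  positivity

/-- A monotone mass that vanishes at 0 and at R vanishes between them, and so does its derivative
r^m φ²; but φ is positive near the origin. -/
theorem radialMass_ne_zero {R : ℝ} (hR : 0 < R) : radialMass m R ≠ 0 := by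
  intro h0
  have hzero : ∀ r ∈ Set.Icc 0 R, radialMass m r = 0 := by
    intro r hr
    refine le_antisymm ?_ ?_
    · rw [← h0]
      exact monotoneOn_radialMass m hr.1 hR.le hr.2
    · have := monotoneOn_radialMass m (Set.self_mem_Ici (a := (0 : ℝ))) hr.1 hr.1
      simpa [radialMass] using this
  have hpos : ∀ᶠ r in 𝓝[>] (0 : ℝ), 0 < Φ₀ (r ^ 2) := by
    have hc : Continuous fun r : ℝ => Φ₀ (r ^ 2) :=
      (continuous_besselSeries m 0).comp (continuous_pow 2)
    refine (hc.tendsto 0).mono_left nhdsWithin_le_nhds |>.eventually_const_lt ?_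
    simp [besselSeries_zero]
  obtain ⟨r, hr1, hr2⟩ := (hpos.and (Ioo_mem_nhdsGT hR)).exists
  have hev : radialMass m =ᶠ[𝓝 r] fun _ => 0 := by
    filter_upwards [Ioo_mem_nhds hr2.1 hr2.2] with x hx
    exact hzero x ⟨hx.1.le, hx.2.le⟩
  have hd := ((hasDerivAt_radialMass m r).congr_of_eventuallyEq hev.symm).unique
    (hasDerivAt_const r (0 : ℝ))
  have : 0 < r := hr2.1
  have : 0 < r ^ m * Φ₀ (r ^ 2) ^ 2 := by positivity
  exact this.ne' hd

/-- The energy `r ^ m * (φ ^ 2 + φ' ^ 2)` of `φ r = Φ (r²)`. -/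
noncomputable def radialEnergy (r : ℝ) : ℝ :=
  r ^ m * (Φ₀ (r ^ 2) ^ 2 + 4 * r ^ 2 * Φ₁ (r ^ 2) ^ 2)

/-- The energy with a correction that makes its derivative integrable at infinity. -/
noncomputable def correctedEnergy (r : ℝ) : ℝ :=
  radialEnergy m r + r ^ m * (2 * m * (Φ₀ (r ^ 2) * Φ₁ (r ^ 2)))

/-- The energy alone has derivative m r^(m-1) (φ² - φ'²), too large by a factor r to integrate.
Adding m r^(m-1) φ φ' cancels it and leaves -m r^(m-2) φ φ', of relative size r⁻². -/
theorem hasDerivAt_correctedEnergy {r : ℝ} (hr : 0 < r) :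
    HasDerivAt (correctedEnergy m)
      (-(m / r ^ 2) * (r ^ m * (2 * r * (Φ₀ (r ^ 2) * Φ₁ (r ^ 2))))) r := by
  have h0 := (hasDerivAt_besselSeries m 0 (r ^ 2)).comp r (hasDerivAt_pow 2 r)
  have h1 := (hasDerivAt_besselSeries m 1 (r ^ 2)).comp r (hasDerivAt_pow 2 r)
  have hp := hasDerivAt_pow m r
  have h := (hp.mul ((h0.pow 2).add (((hasDerivAt_pow 2 r).const_mul 4).mul (h1.pow 2)))).add
    (hp.mul ((h0.mul h1).const_mul (2 * (m : ℝ))))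
  refine h.congr_deriv ?_
  -- For m = 0 the exponent m - 1 is truncated, but the factor m then vanishes.
  have hq : (m : ℝ) * r ^ (m - 1) * r = m * r ^ m := by
    rcases m with _ | k
    · simp
    · rw [Nat.add_sub_cancel]
      ring
  have hode := besselSeries_ode m (r ^ 2)
  simp only [Function.comp_apply, Nat.cast_ofNat, Pi.pow_apply, pow_one, Nat.add_one_sub_one,
    Pi.add_apply, Pi.mul_apply, zero_add, Nat.reduceAdd]
  refine mul_right_cancel₀ hr.ne' ?_
  rw [show -((m : ℝ) / r ^ 2) * (r ^ m * (2 * r * (Φ₀ (r ^ 2) * Φ₁ (r ^ 2)))) * r =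
    -(2 * m) * (r ^ m * (Φ₀ (r ^ 2) * Φ₁ (r ^ 2))) by field_simp]
  linear_combination (Φ₀ (r ^ 2) ^ 2 + 4 * r ^ 2 * Φ₁ (r ^ 2) ^ 2 +
    2 * m * (Φ₀ (r ^ 2) * Φ₁ (r ^ 2))) * hq +
    (r ^ m * (4 * r ^ 2 * Φ₁ (r ^ 2) + m * Φ₀ (r ^ 2))) * hode

end RadialSolution

/-! ### Two-sided energy bounds and linear growth of the mass -/

section RadialBounds

variable (m : ℕ)

local notation "Φ₀" => besselSeries m 0
local notation "Φ₁" => besselSeries m 1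

theorem abs_two_mul_mul_le (r y z : ℝ) :
    |2 * r * (y * z)| ≤ (y ^ 2 + 4 * r ^ 2 * z ^ 2) / 2 := by
  rw [abs_le]
  constructor <;> nlinarith [sq_nonneg (y + 2 * r * z), sq_nonneg (y - 2 * r * z)]

theorem abs_cross_le_radialEnergy {r : ℝ} (hr : 0 ≤ r) :
    |r ^ m * (2 * r * (Φ₀ (r ^ 2) * Φ₁ (r ^ 2)))| ≤ radialEnergy m r / 2 := by
  rw [abs_mul, abs_of_nonneg (by positivity : 0 ≤ r ^ m), radialEnergy, mul_div_assoc]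
  gcongr
  exact abs_two_mul_mul_le _ _ _

theorem radialEnergy_nonneg {r : ℝ} (hr : 0 ≤ r) : 0 ≤ radialEnergy m r := by
  unfold radialEnergy
  positivity

/-- Lommel's form expresses the mass as half of r times the energy, up to a term bounded by a
multiple of the energy. Linear growth then needs no averaging of the oscillating φ². -/
theorem radialMass_eq (r : ℝ) : radialMass m r =
    (r * radialEnergy m r + (m - 1) * (r ^ m * (2 * r * (Φ₀ (r ^ 2) * Φ₁ (r ^ 2))))) / 2 := by
  simp only [radialMass, radialEnergy, lommel]
  ring

theorem radialEnergy_pos {r : ℝ} (hr : 0 < r) : 0 < radialEnergy m r := by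
  refine lt_of_le_of_ne (radialEnergy_nonneg m hr.le) fun h => ?_
  refine radialMass_ne_zero m hr ?_
  have h1 := abs_cross_le_radialEnergy m hr.le
  rw [← h, zero_div] at h1
  rw [radialMass_eq, ← h, abs_eq_zero.1 (le_antisymm h1 (abs_nonneg _))]
  simp

/-- The correction is m / r times the cross term r^m φ φ', and m / r ≤ 1 in this range. -/
theorem abs_correctedEnergy_sub_le {r : ℝ} (hr : m + 1 ≤ r) :
    |correctedEnergy m r - radialEnergy m r| ≤ radialEnergy m r / 2 := by
  have hm : (0 : ℝ) ≤ m := by positivity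
  have hr0 : 0 < r := by linarith
  refine le_trans ?_ (abs_cross_le_radialEnergy m hr0.le)
  rw [correctedEnergy, add_sub_cancel_left, abs_mul, abs_mul, abs_mul (r ^ m),
    abs_mul (2 * r), abs_of_nonneg (by positivity : 0 ≤ 2 * (m : ℝ)),
    abs_of_nonneg (by positivity : 0 ≤ 2 * r)]
  gcongr
  linarith

theorem abs_deriv_correctedEnergy_le {r : ℝ} (hr : m + 1 ≤ r) :
    |-(m / r ^ 2) * (r ^ m * (2 * r * (Φ₀ (r ^ 2) * Φ₁ (r ^ 2))))| ≤
      m / r ^ 2 * correctedEnergy m r := by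
  have hm : (0 : ℝ) ≤ m := by positivity
  have hr0 : 0 < r := by linarith
  rw [abs_mul, abs_neg, abs_of_nonneg (by positivity : (0 : ℝ) ≤ m / r ^ 2)]
  gcongr
  have h1 := abs_cross_le_radialEnergy m hr0.le
  have h2 := abs_le.1 (abs_correctedEnergy_sub_le m hr)
  linarith [h2.1]

/-- An integrating factor: since |G'| ≤ (m / r²) G, the product G exp(a / r) decreases for a = m and
increases for a = -m. -/
theorem hasDerivAt_correctedEnergy_mul_exp (a : ℝ) {r : ℝ} (hr : 0 < r) :
    HasDerivAt (fun r => correctedEnergy m r * Real.exp (a * r⁻¹))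
      ((-(m / r ^ 2) * (r ^ m * (2 * r * (Φ₀ (r ^ 2) * Φ₁ (r ^ 2)))) -
        a / r ^ 2 * correctedEnergy m r) * Real.exp (a * r⁻¹)) r := by
  have h := (hasDerivAt_correctedEnergy m hr).mul
    (((hasDerivAt_inv hr.ne').const_mul a).exp)
  refine h.congr_deriv ?_
  field_simp
  ring

/-- The energy is bounded from above and from below. -/
theorem exists_radialEnergy_bounds :
    ∃ c C : ℝ, 0 < c ∧ ∀ r : ℝ, m + 1 ≤ r → c ≤ radialEnergy m r ∧ radialEnergy m r ≤ C := by
  have hm : (0 : ℝ) ≤ m := by positivity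
  set R : ℝ := m + 1 with hR
  have hR0 : 0 < R := by positivity
  have hanti : AntitoneOn (fun r => correctedEnergy m r * Real.exp (m * r⁻¹)) (Set.Ici R) := by
    refine antitoneOn_of_deriv_nonpos (convex_Ici R)
      (fun r hr => (hasDerivAt_correctedEnergy_mul_exp m m
        (hR0.trans_le hr)).continuousAt.continuousWithinAt)
      (fun r hr => (hasDerivAt_correctedEnergy_mul_exp m m
        (hR0.trans_le (interior_subset hr))).differentiableAt.differentiableWithinAt)
      fun r hr => ?_
    have hr' : R ≤ r := interior_subset hr
    rw [(hasDerivAt_correctedEnergy_mul_exp m m (hR0.trans_le hr')).deriv]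
    refine mul_nonpos_of_nonpos_of_nonneg ?_ (Real.exp_pos _).le
    linarith [(abs_le.1 (abs_deriv_correctedEnergy_le m hr')).2]
  have hmono : MonotoneOn (fun r => correctedEnergy m r * Real.exp (-m * r⁻¹)) (Set.Ici R) := by
    refine monotoneOn_of_deriv_nonneg (convex_Ici R)
      (fun r hr => (hasDerivAt_correctedEnergy_mul_exp m (-m)
        (hR0.trans_le hr)).continuousAt.continuousWithinAt)
      (fun r hr => (hasDerivAt_correctedEnergy_mul_exp m (-m)
        (hR0.trans_le (interior_subset hr))).differentiableAt.differentiableWithinAt)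
      fun r hr => ?_
    have hr' : R ≤ r := interior_subset hr
    rw [(hasDerivAt_correctedEnergy_mul_exp m (-m) (hR0.trans_le hr')).deriv]
    refine mul_nonneg ?_ (Real.exp_pos _).le
    rw [neg_div, neg_mul (_ / _) (correctedEnergy m r), sub_neg_eq_add]
    linarith [(abs_le.1 (abs_deriv_correctedEnergy_le m hr')).1]
  have hbd : ∀ r, R ≤ r → radialEnergy m r / 2 ≤ correctedEnergy m r ∧
      correctedEnergy m r ≤ 3 / 2 * radialEnergy m r := fun r hr => by
    have h := abs_le.1 (abs_correctedEnergy_sub_le m hr)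
    constructor <;> linarith [h.1, h.2]
  have hGR : 0 < correctedEnergy m R := by
    linarith [(hbd R le_rfl).1, radialEnergy_pos m hR0]
  -- The corrected energy lies between 1/2 and 3/2 of the energy, whence the factors 2 and 2/3; the
  -- exponentials bound its variation on [R, ∞).
  refine ⟨2 / 3 * (correctedEnergy m R * Real.exp (-m * R⁻¹)),
    2 * (correctedEnergy m R * Real.exp (m * R⁻¹)), by positivity, fun r hr => ?_⟩
  have hr0 : 0 < r := hR0.trans_le hr
  have h1 := hanti (Set.self_mem_Ici) hr hr
  have h2 := hmono (Set.self_mem_Ici) hr hr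
  simp only at h1 h2
  have hG : 0 ≤ correctedEnergy m r := by
    linarith [(hbd r hr).1, radialEnergy_nonneg m hr0.le]
  have h3 : correctedEnergy m r ≤ correctedEnergy m r * Real.exp (m * r⁻¹) :=
    le_mul_of_one_le_right hG (Real.one_le_exp (by positivity))
  have h4 : correctedEnergy m r * Real.exp (-m * r⁻¹) ≤ correctedEnergy m r :=
    mul_le_of_le_one_right hG (Real.exp_le_one_iff.2 (by
      have : 0 ≤ (m : ℝ) * r⁻¹ := by positivity
      linarith))
  constructor <;> linarith [(hbd r hr).1, (hbd r hr).2]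

/-- `φ` and `φ'` decay like `r ^ (-m / 2)`. -/
theorem exists_besselSeries_bound : ∃ B : ℝ, 0 < B ∧ ∀ r : ℝ, 0 ≤ r →
    (1 + r) ^ m * (Φ₀ (r ^ 2) ^ 2 + (1 + r) ^ 2 * Φ₁ (r ^ 2) ^ 2) ≤ B := by
  obtain ⟨c, C, hc, hb⟩ := exists_radialEnergy_bounds m
  have h0 := continuous_besselSeries m 0
  have h1 := continuous_besselSeries m 1
  have hcont : Continuous fun r : ℝ =>
      (1 + r) ^ m * (Φ₀ (r ^ 2) ^ 2 + (1 + r) ^ 2 * Φ₁ (r ^ 2) ^ 2) := by fun_prop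
  obtain ⟨D, hD⟩ := (isCompact_Icc (a := (0 : ℝ)) (b := m + 1)).bddAbove_image hcont.continuousOn
  refine ⟨max 1 (max D (2 ^ m * C)), by positivity, fun r hr => ?_⟩
  rcases le_total r (m + 1) with h | h
  · exact ((hD ⟨r, ⟨hr, h⟩, rfl⟩).trans (le_max_left _ _)).trans (le_max_right _ _)
  · have hm : (0 : ℝ) ≤ m := by positivity
    have h2 : 1 + r ≤ 2 * r := by linarith
    refine le_trans ?_ ((le_max_right D _).trans (le_max_right 1 _))
    calc (1 + r) ^ m * (Φ₀ (r ^ 2) ^ 2 + (1 + r) ^ 2 * Φ₁ (r ^ 2) ^ 2)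
        ≤ (2 * r) ^ m * (Φ₀ (r ^ 2) ^ 2 + (2 * r) ^ 2 * Φ₁ (r ^ 2) ^ 2) := by gcongr
      _ = 2 ^ m * radialEnergy m r := by
        rw [radialEnergy, mul_pow]
        ring
      _ ≤ 2 ^ m * C := by
        gcongr
        exact (hb r h).2

/-- `radialMass` grows at least linearly. -/
theorem exists_le_radialMass : ∃ K : ℝ, 1 ≤ K ∧ ∀ r : ℝ, 0 ≤ r →
    r ≤ K * (1 + |radialMass m r|) := by
  obtain ⟨c, C, hc, hb⟩ := exists_radialEnergy_bounds m
  have hm : (0 : ℝ) ≤ m := by positivity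
  have hC : 0 < C := hc.trans_le ((hb (m + 1) le_rfl).1.trans (hb (m + 1) le_rfl).2)
  -- The summand m + 1 covers r ≤ m + 1; the quotient comes from r c ≤ 2 |g| + |m - 1| C beyond it.
  refine ⟨(m + 1) + (2 + |(m : ℝ) - 1| * C) / c, ?_, fun r hr => ?_⟩
  · have : 0 ≤ (2 + |(m : ℝ) - 1| * C) / c := by positivity
    linarith
  · have hg := abs_nonneg (radialMass m r)
    rcases le_total r (m + 1) with h | h
    · have : 0 ≤ (2 + |(m : ℝ) - 1| * C) / c := by positivity
      nlinarith [mul_nonneg this hg, mul_nonneg hm hg]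
    · have h1 := abs_cross_le_radialEnergy m hr
      have h2 := radialMass_eq m r
      have h3 : |((m : ℝ) - 1) * (r ^ m * (2 * r * (Φ₀ (r ^ 2) * Φ₁ (r ^ 2))))| ≤
          |(m : ℝ) - 1| * C := by
        rw [abs_mul]
        gcongr
        linarith [(hb r h).2]
      have h4 : r * c ≤ r * radialEnergy m r := by
        gcongr
        exact (hb r h).1
      have h5 : r * c ≤ 2 * |radialMass m r| + |(m : ℝ) - 1| * C := by
        linarith [(abs_le.1 h3).1, le_abs_self (radialMass m r)]
      have h6 : r ≤ (2 * |radialMass m r| + |(m : ℝ) - 1| * C) / c := (le_div_iff₀ hc).2 h5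
      refine h6.trans ?_
      have h7 : 0 ≤ |(m : ℝ) - 1| * C := by positivity
      calc (2 * |radialMass m r| + |(m : ℝ) - 1| * C) / c
          ≤ (2 + |(m : ℝ) - 1| * C) * (1 + |radialMass m r|) / c := by
            gcongr
            nlinarith [mul_nonneg h7 hg]
        _ = (2 + |(m : ℝ) - 1| * C) / c * (1 + |radialMass m r|) := by ring
        _ ≤ _ := by
            gcongr
            linarith

end RadialBounds

/-! ### The damped solution, its equation and the bound on the potential -/

section Profile

variable (m : ℕ) (t : ℝ)

local notation "Φ₀" => besselSeries m 0
local notation "Φ₁" => besselSeries m 1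
local notation "Φ₂" => besselSeries m 2

/-- The damping factor `1 / (t ^ 2 + g ^ 2)` with `g = radialMass m r`, in the variable
`s = r ^ 2`. -/
noncomputable def damping (s : ℝ) : ℝ := (t ^ 2 + s ^ (m + 1) * lommel m s ^ 2)⁻¹

/-- The eigenfunction as a function of `s = |x|²`. -/
noncomputable def profile (s : ℝ) : ℝ := Φ₀ s * damping m t s

/-- The first derivative of `profile`. -/
noncomputable def profileDeriv (s : ℝ) : ℝ :=
  Φ₁ s * damping m t s - s ^ m * lommel m s * Φ₀ s ^ 3 * damping m t s ^ 2

/-- The second derivative of `profile`. -/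
noncomputable def profileDeriv2 (s : ℝ) : ℝ :=
  Φ₂ s * damping m t s - 2 * (s ^ m * lommel m s * Φ₀ s ^ 2 * Φ₁ s * damping m t s ^ 2) -
    (m * s ^ (m - 1) * lommel m s * Φ₀ s ^ 3 + s ^ m * lommelDeriv m s * Φ₀ s ^ 3 +
      2 * (s ^ m * lommel m s * Φ₀ s ^ 2 * Φ₁ s)) * damping m t s ^ 2 +
    2 * (s ^ m * lommel m s) ^ 2 * Φ₀ s ^ 5 * damping m t s ^ 3

/-- The potential as a function of `s = |x|²`. -/
noncomputable def potentialProfile (s : ℝ) : ℝ :=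
  8 * s ^ (2 * m + 1) * lommel m s ^ 2 * Φ₀ s ^ 4 * damping m t s ^ 2 -
    (16 * s ^ (m + 1) * lommel m s * (Φ₀ s * Φ₁ s) + 4 * m * s ^ m * lommel m s * Φ₀ s ^ 2 +
      2 * s ^ m * Φ₀ s ^ 4) * damping m t s

variable {m t}

theorem damping_denom_pos (ht : 0 < t) {s : ℝ} (hs : 0 ≤ s) :
    0 < t ^ 2 + s ^ (m + 1) * lommel m s ^ 2 := by positivity

theorem damping_pos (ht : 0 < t) {s : ℝ} (hs : 0 ≤ s) : 0 < damping m t s :=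
  inv_pos.2 (damping_denom_pos ht hs)

theorem hasDerivAt_damping (ht : 0 < t) {s : ℝ} (hs : 0 ≤ s) :
    HasDerivAt (damping m t) (-(s ^ m * lommel m s * Φ₀ s ^ 2) * damping m t s ^ 2) s := by
  have hne := (damping_denom_pos (m := m) ht hs).ne'
  have h := (((hasDerivAt_pow (m + 1) s).mul ((hasDerivAt_lommel m s).pow 2)).const_add
    (t ^ 2)).inv hne
  refine h.congr_deriv ?_
  rw [← lommel_add_lommelDeriv, damping]
  simp only [Nat.cast_add, Nat.cast_one, Nat.cast_ofNat, Nat.add_sub_cancel, Pi.mul_apply,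
    Pi.pow_apply]
  rw [inv_pow, div_eq_mul_inv]
  ring

theorem hasDerivAt_profile (ht : 0 < t) {s : ℝ} (hs : 0 ≤ s) :
    HasDerivAt (profile m t) (profileDeriv m t s) s := by
  refine ((hasDerivAt_besselSeries m 0 s).mul (hasDerivAt_damping ht hs)).congr_deriv ?_
  rw [profileDeriv]
  ring

theorem hasDerivAt_profileDeriv (ht : 0 < t) {s : ℝ} (hs : 0 ≤ s) :
    HasDerivAt (profileDeriv m t) (profileDeriv2 m t s) s := by
  have hW := hasDerivAt_damping (m := m) ht hs
  have h := ((hasDerivAt_besselSeries m 1 s).mul hW).sub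
    ((((hasDerivAt_pow m s).mul (hasDerivAt_lommel m s)).mul
      ((hasDerivAt_besselSeries m 0 s).pow 3)).mul (hW.pow 2))
  refine h.congr_deriv ?_
  rw [profileDeriv2]
  simp only [Nat.cast_ofNat, Pi.mul_apply, Pi.pow_apply, Nat.add_one_sub_one, pow_one]
  ring

/-- The radial Schrödinger equation. -/
theorem profile_equation (s : ℝ) :
    4 * s * profileDeriv2 m t s + 2 * (m + 1) * profileDeriv m t s + profile m t s =
      potentialProfile m t s * profile m t s := by
  have hq : (m : ℝ) * s ^ (m - 1) * s = m * s ^ m := by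
    rcases m with _ | k
    · simp
    · rw [Nat.add_sub_cancel]
      ring
  simp only [profile, profileDeriv, profileDeriv2, potentialProfile]
  -- The three identities remove Φ₂, `lommelDeriv` and s^(m-1), none of which occurs in the
  -- potential.
  linear_combination damping m t s * besselSeries_ode m s -
    2 * s ^ m * Φ₀ s ^ 3 * damping m t s ^ 2 * lommel_add_lommelDeriv m s -
    4 * lommel m s * Φ₀ s ^ 3 * damping m t s ^ 2 * hq

theorem continuousOn_damping (ht : 0 < t) : ContinuousOn (damping m t) (Set.Ici 0) :=
  fun _ hs => (hasDerivAt_damping ht hs).continuousAt.continuousWithinAt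

theorem continuousOn_profileDeriv (ht : 0 < t) : ContinuousOn (profileDeriv m t) (Set.Ici 0) :=
  fun _ hs => (hasDerivAt_profileDeriv ht hs).continuousAt.continuousWithinAt

theorem continuousOn_profileDeriv2 (ht : 0 < t) : ContinuousOn (profileDeriv2 m t) (Set.Ici 0) := by
  have hW := continuousOn_damping (m := m) ht
  have h0 := (continuous_besselSeries m 0).continuousOn (s := Set.Ici (0 : ℝ))
  have h1 := (continuous_besselSeries m 1).continuousOn (s := Set.Ici (0 : ℝ))
  have h2 := (continuous_besselSeries m 2).continuousOn (s := Set.Ici (0 : ℝ))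
  have h3 := (continuous_lommel m).continuousOn (s := Set.Ici (0 : ℝ))
  have h4 := (continuous_lommelDeriv m).continuousOn (s := Set.Ici (0 : ℝ))
  unfold profileDeriv2
  fun_prop

theorem continuousOn_potentialProfile (ht : 0 < t) :
    ContinuousOn (potentialProfile m t) (Set.Ici 0) := by
  have hW := continuousOn_damping (m := m) ht
  have h0 := (continuous_besselSeries m 0).continuousOn (s := Set.Ici (0 : ℝ))
  have h1 := (continuous_besselSeries m 1).continuousOn (s := Set.Ici (0 : ℝ))
  have h3 := (continuous_lommel m).continuousOn (s := Set.Ici (0 : ℝ))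
  unfold potentialProfile
  fun_prop

theorem damping_sq_eq (r : ℝ) : damping m t (r ^ 2) = (t ^ 2 + radialMass m r ^ 2)⁻¹ := by
  rw [damping, radialMass]
  ring

theorem radialMass_sq_mul_damping_le (ht : 0 < t) (r : ℝ) :
    radialMass m r ^ 2 * damping m t (r ^ 2) ≤ 1 := by
  rw [damping_sq_eq, ← div_eq_mul_inv]
  refine div_le_one_of_le₀ ?_ (by positivity)
  linarith [sq_nonneg t]

variable (m)

/-- The damping factor decays quadratically, uniformly in `t ≥ 1`. -/
theorem exists_damping_le : ∃ K : ℝ, 1 ≤ K ∧ ∀ t : ℝ, 1 ≤ t → ∀ r : ℝ, 0 ≤ r →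
    damping m t (r ^ 2) ≤ (K / (t + r)) ^ 2 := by
  obtain ⟨K, hK, h⟩ := exists_le_radialMass m
  refine ⟨4 * K, by linarith, fun t ht r hr => ?_⟩
  have h1 : t + r ≤ 2 * K * (t + |radialMass m r|) := by
    have hg := abs_nonneg (radialMass m r)
    have := h r hr
    nlinarith [mul_nonneg (sub_nonneg.2 hK) hg, mul_nonneg (sub_nonneg.2 ht) (sub_nonneg.2 hK)]
  have h2 : (t + r) ^ 2 ≤ (4 * K) ^ 2 * (t ^ 2 + radialMass m r ^ 2) := by
    calc (t + r) ^ 2 ≤ (2 * K * (t + |radialMass m r|)) ^ 2 := by gcongr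
      _ = 4 * K ^ 2 * (t + |radialMass m r|) ^ 2 := by ring
      _ ≤ 4 * K ^ 2 * (2 * (t ^ 2 + |radialMass m r| ^ 2)) := by
        gcongr
        nlinarith [sq_nonneg (t - |radialMass m r|)]
      _ = 8 * K ^ 2 * (t ^ 2 + radialMass m r ^ 2) := by
        rw [sq_abs]
        ring
      _ ≤ _ := by
        have : 0 ≤ K ^ 2 * (t ^ 2 + radialMass m r ^ 2) := by positivity
        nlinarith
  have h3 : 0 < t + r := by linarith
  rw [damping_sq_eq, inv_eq_one_div, div_pow, div_le_div_iff₀ (by positivity) (by positivity)]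
  linarith

variable {m}

theorem pow_mul_sq_le {B r y z : ℝ} (hr : 0 ≤ r)
    (hB : (1 + r) ^ m * (y ^ 2 + (1 + r) ^ 2 * z ^ 2) ≤ B) : r ^ m * y ^ 2 ≤ B := by
  refine le_trans ?_ hB
  have h : 0 ≤ (1 + r) ^ 2 * z ^ 2 := by positivity
  gcongr <;> linarith

theorem abs_pow_mul_mul_le {B r y z : ℝ} (hr : 0 ≤ r)
    (hB : (1 + r) ^ m * (y ^ 2 + (1 + r) ^ 2 * z ^ 2) ≤ B) : |r ^ (m + 1) * (y * z)| ≤ B := by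
  have h1 : |r * (y * z)| ≤ y ^ 2 + (1 + r) ^ 2 * z ^ 2 := by
    have h2 : 0 ≤ r * z ^ 2 := by positivity
    rw [abs_le]
    constructor <;>
      linarith [sq_nonneg (y + r * z), sq_nonneg (y - r * z), h2,
        sq_nonneg z, sq_nonneg y, sq_nonneg (r * z)]
  calc |r ^ (m + 1) * (y * z)| = r ^ m * |r * (y * z)| := by
        rw [pow_succ, mul_assoc, abs_mul, abs_of_nonneg (by positivity : 0 ≤ r ^ m)]
    _ ≤ (1 + r) ^ m * (y ^ 2 + (1 + r) ^ 2 * z ^ 2) := by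
        gcongr
        linarith
    _ ≤ B := hB

/-- The factor is a = m r^(m-1) y². It stays bounded at the origin because it vanishes when m = 0,
the only case where r^(m-1) would be singular. -/
theorem exists_eq_mul_radialMass {B r y z : ℝ} (hr : 0 ≤ r)
    (hB : (1 + r) ^ m * (y ^ 2 + (1 + r) ^ 2 * z ^ 2) ≤ B) :
    ∃ a : ℝ, |a| ≤ m * B ∧ m * (r ^ 2) ^ m * lommel m (r ^ 2) * y ^ 2 = a * radialMass m r := by
  rcases m with _ | k
  · exact ⟨0, by simp, by simp⟩
  · refine ⟨((k + 1 : ℕ) : ℝ) * (r ^ k * y ^ 2), ?_, ?_⟩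
    · rw [abs_of_nonneg (by positivity)]
      gcongr
      refine le_trans ?_ hB
      have h : 0 ≤ (1 + r) ^ 2 * z ^ 2 := by positivity
      have h1 : r ^ k ≤ (1 + r) ^ (k + 1) := by
        calc r ^ k ≤ (1 + r) ^ k := by
              gcongr
              linarith
          _ ≤ (1 + r) ^ (k + 1) := pow_le_pow_right₀ (by linarith) (Nat.le_succ k)
      gcongr
      linarith
    · rw [radialMass]
      ring

/-- With W the damping factor, (g W)² = (g² W) W ≤ W. -/
theorem abs_radialMass_mul_damping_le (ht : 0 < t) {r k : ℝ} (hk : 0 ≤ k)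
    (hW : damping m t (r ^ 2) ≤ k ^ 2) : |radialMass m r * damping m t (r ^ 2)| ≤ k := by
  refine abs_le_of_sq_le_sq ?_ hk
  have hpos := damping_pos (m := m) ht (sq_nonneg r)
  calc (radialMass m r * damping m t (r ^ 2)) ^ 2
      = (radialMass m r ^ 2 * damping m t (r ^ 2)) * damping m t (r ^ 2) := by ring
    _ ≤ 1 * damping m t (r ^ 2) := by
      gcongr
      exact radialMass_sq_mul_damping_le ht r
    _ ≤ k ^ 2 := by linarith

theorem abs_potentialProfile_le_of_bounds (ht : 0 < t) {B r k : ℝ} (hr : 0 ≤ r) (hk : 0 ≤ k)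
    (hW : damping m t (r ^ 2) ≤ k ^ 2)
    (hB : (1 + r) ^ m * (Φ₀ (r ^ 2) ^ 2 + (1 + r) ^ 2 * Φ₁ (r ^ 2) ^ 2) ≤ B) :
    |potentialProfile m t (r ^ 2)| ≤ 10 * B ^ 2 * k ^ 2 + (16 + 4 * m) * B * k := by
  have hA := pow_mul_sq_le hr hB
  have hyz := abs_pow_mul_mul_le hr hB
  obtain ⟨a, ha, hag⟩ := exists_eq_mul_radialMass hr hB
  have hgW := abs_radialMass_mul_damping_le ht hk hW
  have hWpos := damping_pos (m := m) ht (sq_nonneg r)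
  -- Each term is grouped as bounded factors times (g W)², g W or W, of orders k², k and k²; the
  -- coefficients 8 + 2 and 16 + 4m give the constants.
  have hV : potentialProfile m t (r ^ 2) =
      8 * ((radialMass m r * damping m t (r ^ 2)) ^ 2 * (r ^ m * Φ₀ (r ^ 2) ^ 2) ^ 2) -
      16 * ((radialMass m r * damping m t (r ^ 2)) * (r ^ (m + 1) * (Φ₀ (r ^ 2) * Φ₁ (r ^ 2)))) -
      4 * (a * (radialMass m r * damping m t (r ^ 2))) -
      2 * ((r ^ m * Φ₀ (r ^ 2) ^ 2) ^ 2 * damping m t (r ^ 2)) := by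
    rw [← mul_assoc a, ← hag, radialMass, potentialProfile]
    ring
  rw [hV]
  clear hV hag hB
  generalize damping m t (r ^ 2) = W at *
  generalize radialMass m r * W = q at *
  have hA0 : 0 ≤ r ^ m * Φ₀ (r ^ 2) ^ 2 := by positivity
  generalize r ^ m * Φ₀ (r ^ 2) ^ 2 = A at *
  generalize r ^ (m + 1) * (Φ₀ (r ^ 2) * Φ₁ (r ^ 2)) = D at *
  have hB0 : 0 ≤ B := hA0.trans hA
  have e1 : q ^ 2 * A ^ 2 ≤ k ^ 2 * B ^ 2 := by
    rw [← sq_abs q]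
    gcongr
  have e2 : |q * D| ≤ k * B := by
    rw [abs_mul]
    gcongr
  have e3 : |a * q| ≤ (m * B) * k := by
    rw [abs_mul]
    gcongr
  have e4 : A ^ 2 * W ≤ B ^ 2 * k ^ 2 := by gcongr
  have e5 : 0 ≤ q ^ 2 * A ^ 2 := by positivity
  have e6 : 0 ≤ A ^ 2 * W := by positivity
  have e7 : 0 ≤ B ^ 2 * k ^ 2 := by positivity
  rw [abs_le] at e2 e3 ⊢
  constructor <;> linarith [e2.1, e2.2, e3.1, e3.2]

variable (m)

theorem exists_abs_potentialProfile_le : ∃ C : ℝ, 0 < C ∧ ∀ t : ℝ, 1 ≤ t → ∀ r : ℝ, 0 ≤ r →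
    |potentialProfile m t (r ^ 2)| ≤ C / (t + r) := by
  obtain ⟨K, hK, hW⟩ := exists_damping_le m
  obtain ⟨B, hB0, hB⟩ := exists_besselSeries_bound m
  refine ⟨10 * B ^ 2 * K ^ 2 + (16 + 4 * m) * B * K, by positivity, fun t ht r hr => ?_⟩
  have hd0 : 0 < t + r := by linarith
  have hd1 : (t + r)⁻¹ ≤ 1 := inv_le_one_of_one_le₀ (by linarith)
  have hdpos : 0 < (t + r)⁻¹ := inv_pos.2 hd0
  have hd2 : (t + r)⁻¹ ^ 2 ≤ (t + r)⁻¹ := pow_le_of_le_one hdpos.le hd1 two_ne_zero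
  refine (abs_potentialProfile_le_of_bounds (by linarith) hr (by positivity)
    (hW t ht r hr) (hB r hr)).trans ?_
  rw [div_eq_mul_inv, div_eq_mul_inv, mul_pow]
  calc 10 * B ^ 2 * (K ^ 2 * (t + r)⁻¹ ^ 2) + (16 + 4 * m) * B * (K * (t + r)⁻¹)
      ≤ 10 * B ^ 2 * (K ^ 2 * (t + r)⁻¹) + (16 + 4 * m) * B * (K * (t + r)⁻¹) := by gcongr
    _ = _ := by ring

end Profile

/-! ### Square-integrable decay of the profile and its derivatives -/

section Decay

variable (m : ℕ)

local notation "Φ₀" => besselSeries m 0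
local notation "Φ₁" => besselSeries m 1

/-- A decay rate which is square integrable on `ℝ^(m+1)`. -/
noncomputable def decayRate (r : ℝ) : ℝ := (√((1 + r) ^ (m + 4)))⁻¹

theorem decayRate_pos {r : ℝ} (hr : 0 ≤ r) : 0 < decayRate m r := by
  unfold decayRate
  positivity

theorem memLp_decayRate :
    MemLp (fun x : EuclideanSpace ℝ (Fin (m + 1)) => decayRate m ‖x‖) 2 volume := by
  have hmeas : Measurable fun x : EuclideanSpace ℝ (Fin (m + 1)) => decayRate m ‖x‖ := by
    unfold decayRate
    fun_prop
  rw [memLp_two_iff_integrable_sq hmeas.aestronglyMeasurable]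
  have hr : (Module.finrank ℝ (EuclideanSpace ℝ (Fin (m + 1))) : ℝ) < ((m + 4 : ℕ) : ℝ) := by
    rw [finrank_euclideanSpace_fin]
    push_cast
    linarith
  refine (integrable_one_add_norm hr).congr (Eventually.of_forall fun x => ?_)
  have h : 0 ≤ 1 + ‖x‖ := by positivity
  simp only [decayRate]
  rw [inv_pow, Real.sq_sqrt (by positivity), Real.rpow_neg h, Real.rpow_natCast]

theorem memLp_two_of_norm_le_decayRate {F : EuclideanSpace ℝ (Fin (m + 1)) → ℂ}
    (hF : Continuous F) {C : ℝ} (h : ∀ x, ‖F x‖ ≤ C * decayRate m ‖x‖) : MemLp F 2 volume := by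
  refine (memLp_decayRate m).of_le_mul (c := C) hF.aestronglyMeasurable
    (Eventually.of_forall fun x => ?_)
  rw [Real.norm_of_nonneg (decayRate_pos m (norm_nonneg x)).le]
  exact h x

/-- A factor that decays like `φ`, times the damping factor, is `O (decayRate)`. -/
theorem exists_abs_mul_damping_le (B : ℝ) : ∃ C : ℝ, 0 ≤ C ∧ ∀ t : ℝ, 1 ≤ t → ∀ r y : ℝ, 0 ≤ r →
    (1 + r) ^ m * y ^ 2 ≤ B → |y * damping m t (r ^ 2)| ≤ C * decayRate m r := by
  obtain ⟨K, hK, hW⟩ := exists_damping_le m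
  refine ⟨√(B * K ^ 4), Real.sqrt_nonneg _, fun t ht r y hr hy => ?_⟩
  have hr1 : 0 < 1 + r := by linarith
  have hB : 0 ≤ B := le_trans (by positivity) hy
  rw [decayRate, ← div_eq_mul_inv, ← Real.sqrt_div (by positivity)]
  refine Real.abs_le_sqrt ?_
  rw [le_div_iff₀ (by positivity)]
  have h1 : damping m t (r ^ 2) ≤ (K / (1 + r)) ^ 2 :=
    (hW t ht r hr).trans (by gcongr)
  have h0 := damping_pos (m := m) (t := t) (by linarith) (sq_nonneg r)
  calc (y * damping m t (r ^ 2)) ^ 2 * (1 + r) ^ (m + 4)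
      = ((1 + r) ^ m * y ^ 2) * (damping m t (r ^ 2) ^ 2 * (1 + r) ^ 4) := by ring
    _ ≤ B * (((K / (1 + r)) ^ 2) ^ 2 * (1 + r) ^ 4) := by gcongr
    _ = B * K ^ 4 := by
      field_simp

variable {t : ℝ}

theorem exists_abs_profile_le (ht : 1 ≤ t) :
    ∃ C : ℝ, 0 ≤ C ∧ ∀ r : ℝ, 0 ≤ r → |profile m t (r ^ 2)| ≤ C * decayRate m r := by
  obtain ⟨B, hB0, hB⟩ := exists_besselSeries_bound m
  obtain ⟨C, hC, h⟩ := exists_abs_mul_damping_le m B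
  refine ⟨C, hC, fun r hr => h t ht r _ hr (le_trans ?_ (hB r hr))⟩
  have : 0 ≤ (1 + r) ^ 2 * Φ₁ (r ^ 2) ^ 2 := by positivity
  gcongr
  linarith

theorem exists_abs_mul_profileDeriv_le (ht : 1 ≤ t) :
    ∃ C : ℝ, 0 ≤ C ∧ ∀ r : ℝ, 0 ≤ r → |r * profileDeriv m t (r ^ 2)| ≤ C * decayRate m r := by
  obtain ⟨B, hB0, hB⟩ := exists_besselSeries_bound m
  obtain ⟨K, hK, hW⟩ := exists_damping_le m
  obtain ⟨C, hC, h⟩ := exists_abs_mul_damping_le m B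
  refine ⟨C + K * B * C, by positivity, fun r hr => ?_⟩
  have hb := decayRate_pos m hr
  have h1 : |(r * Φ₁ (r ^ 2)) * damping m t (r ^ 2)| ≤ C * decayRate m r := by
    refine h t ht r _ hr (le_trans ?_ (hB r hr))
    have h2 : 0 ≤ Φ₀ (r ^ 2) ^ 2 := by positivity
    rw [mul_pow]
    have h3 : r ^ 2 * Φ₁ (r ^ 2) ^ 2 ≤ (1 + r) ^ 2 * Φ₁ (r ^ 2) ^ 2 := by
      gcongr
      linarith
    gcongr
    linarith
  have h2 : |Φ₀ (r ^ 2) * damping m t (r ^ 2)| ≤ C * decayRate m r := by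
    refine h t ht r _ hr (le_trans ?_ (hB r hr))
    have : 0 ≤ (1 + r) ^ 2 * Φ₁ (r ^ 2) ^ 2 := by positivity
    gcongr
    linarith
  have h3 : |radialMass m r * damping m t (r ^ 2)| ≤ K := by
    refine abs_radialMass_mul_damping_le (by linarith) (by linarith) ((hW t ht r hr).trans ?_)
    gcongr
    exact div_le_self (by linarith) (by linarith)
  have h4 : |r ^ m * Φ₀ (r ^ 2) ^ 2| ≤ B := by
    rw [abs_of_nonneg (by positivity)]
    exact pow_mul_sq_le hr (hB r hr)
  have heq : r * profileDeriv m t (r ^ 2) = (r * Φ₁ (r ^ 2)) * damping m t (r ^ 2) -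
      (radialMass m r * damping m t (r ^ 2)) * (r ^ m * Φ₀ (r ^ 2) ^ 2) *
        (Φ₀ (r ^ 2) * damping m t (r ^ 2)) := by
    rw [profileDeriv, radialMass]
    ring
  rw [heq]
  refine (abs_sub _ _).trans ?_
  rw [abs_mul (_ * _) (Φ₀ (r ^ 2) * _), abs_mul (radialMass m r * _)]
  calc _ ≤ C * decayRate m r + K * B * (C * decayRate m r) := by gcongr
    _ = _ := by ring

/-- The weighted bound suffices for r ≥ 1; on [0, 1] continuity and compactness replace it. -/
theorem exists_abs_profileDeriv_le (ht : 1 ≤ t) :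
    ∃ C : ℝ, 0 ≤ C ∧ ∀ r : ℝ, 0 ≤ r → |profileDeriv m t (r ^ 2)| ≤ C * decayRate m r := by
  obtain ⟨C, hC, h⟩ := exists_abs_mul_profileDeriv_le m ht
  have hcont : ContinuousOn (fun r : ℝ => |profileDeriv m t (r ^ 2)| / decayRate m r)
      (Set.Icc 0 1) := by
    refine ContinuousOn.div ?_ ?_ fun r hr => (decayRate_pos m hr.1).ne'
    · exact ((continuousOn_profileDeriv (by linarith)).comp (continuous_pow 2).continuousOn
        fun r _ => sq_nonneg r).abs
    · unfold decayRate
      refine ContinuousOn.inv₀ (by fun_prop) fun r hr => ?_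
      have : 0 ≤ r := hr.1
      positivity
  obtain ⟨D, hD⟩ := isCompact_Icc.bddAbove_image hcont
  refine ⟨max C D, le_max_of_le_left hC, fun r hr => ?_⟩
  have hb := decayRate_pos m hr
  rcases le_total r 1 with h1 | h1
  · have h2 : |profileDeriv m t (r ^ 2)| / decayRate m r ≤ D := hD ⟨r, ⟨hr, h1⟩, rfl⟩
    rw [div_le_iff₀ hb] at h2
    exact h2.trans (by gcongr; exact le_max_right _ _)
  · have h2 := h r hr
    rw [abs_mul, abs_of_nonneg hr] at h2
    calc |profileDeriv m t (r ^ 2)| ≤ r * |profileDeriv m t (r ^ 2)| :=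
          le_mul_of_one_le_left (abs_nonneg _) h1
      _ ≤ C * decayRate m r := h2
      _ ≤ _ := by gcongr; exact le_max_left _ _

theorem exists_abs_potentialProfile_mul_profile_le (ht : 1 ≤ t) :
    ∃ C : ℝ, 0 ≤ C ∧ ∀ r : ℝ, 0 ≤ r →
      |potentialProfile m t (r ^ 2) * profile m t (r ^ 2)| ≤ C * decayRate m r := by
  obtain ⟨C, hC, h⟩ := exists_abs_profile_le m ht
  obtain ⟨D, hD, hV⟩ := exists_abs_potentialProfile_le m
  refine ⟨D * C, by positivity, fun r hr => ?_⟩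
  have h1 : |potentialProfile m t (r ^ 2)| ≤ D :=
    (hV t ht r hr).trans (div_le_self hD.le (by linarith))
  rw [abs_mul, mul_assoc]
  have := decayRate_pos m hr
  gcongr
  exact h r hr

/-- The radial equation is solved for the second-derivative term, so its explicit formula need not
be estimated. -/
theorem exists_abs_mul_profileDeriv2_le (ht : 1 ≤ t) :
    ∃ C : ℝ, 0 ≤ C ∧ ∀ r : ℝ, 0 ≤ r →
      |4 * r ^ 2 * profileDeriv2 m t (r ^ 2)| ≤ C * decayRate m r := by
  obtain ⟨C₀, hC₀, h₀⟩ := exists_abs_profile_le m ht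
  obtain ⟨C₁, hC₁, h₁⟩ := exists_abs_profileDeriv_le m ht
  obtain ⟨C₂, hC₂, h₂⟩ := exists_abs_potentialProfile_mul_profile_le m ht
  refine ⟨C₂ + C₀ + 2 * (m + 1) * C₁, by positivity, fun r hr => ?_⟩
  have heq := profile_equation (m := m) (t := t) (r ^ 2)
  have e0 := abs_le.1 (h₀ r hr)
  have e2 := abs_le.1 (h₂ r hr)
  have e1 : |2 * ((m : ℝ) + 1) * profileDeriv m t (r ^ 2)| ≤
      2 * (m + 1) * (C₁ * decayRate m r) := by
    rw [abs_mul, abs_of_nonneg (by positivity : 0 ≤ 2 * ((m : ℝ) + 1))]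
    gcongr
    exact h₁ r hr
  rw [abs_le] at e1 ⊢
  constructor <;> linarith [e0.1, e0.2, e1.1, e1.2, e2.1, e2.2]

end Decay

/-! ### The eigenfunction on ℝ^(m+1) -/

section Eigenfunction

/-- If `ψ` has second weak derivatives `K i`, then `(ψ, -∑ i, K i + V ψ)` lies in the graph of
the Schrödinger operator. -/
theorem mem_schrodingerGraph_of_hasWeakGradient {ν : ℕ} {V : EuclideanSpace ℝ (Fin ν) → ℂ}
    {ψ Vψ : L2Space ν} {G K : Fin ν → L2Space ν} (hV : Vψ =ᵐ[volume] fun x => V x * ψ x)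
    (hG : HasWeakGradient ψ G)
    (hK : ∀ i, ∂_{EuclideanSpace.single i (1 : ℝ)} (G i : 𝓢'(EuclideanSpace ℝ (Fin ν), ℂ)) =
      (K i : 𝓢'(EuclideanSpace ℝ (Fin ν), ℂ))) :
    (ψ, Vψ - ∑ i, K i) ∈ schrodingerGraph V := by
  refine ⟨G, hG, fun φ H hH => ?_⟩
  have hae : (fun x => inner ℂ (φ x) (Vψ x)) =ᵐ[volume] fun x => star (φ x) * (V x * ψ x) := by
    filter_upwards [hV] with x hx
    rw [hx, RCLike.inner_apply', RCLike.star_def]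
  refine ⟨(L2.integrable_inner φ Vψ).congr hae, ?_⟩
  rw [← integral_congr_ae hae, ← L2.inner_def, inner_sub_right, inner_sum,
    Finset.sum_congr rfl fun i _ => inner_eq_neg_inner_of_lineDerivOp_eq _ (hH i) (hK i),
    Finset.sum_neg_distrib]
  ring

variable (m : ℕ) (t : ℝ)

local notation "E" => EuclideanSpace ℝ (Fin (m + 1))

/-- The radial potential on `ℝ^(m+1)`. -/
noncomputable def potential (x : E) : ℝ := potentialProfile m t (‖x‖ ^ 2)

/-- The eigenfunction of `-Δ + potential m t` with eigenvalue `1`. -/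
noncomputable def eigenfunction (x : E) : ℂ := (profile m t (‖x‖ ^ 2) : ℝ)

/-- The partial derivatives of `eigenfunction`. -/
noncomputable def eigenfunctionDeriv (i : Fin (m + 1)) (x : E) : ℂ :=
  (2 * x i * profileDeriv m t (‖x‖ ^ 2) : ℝ)

/-- The pure second partial derivatives of `eigenfunction`. -/
noncomputable def eigenfunctionDeriv2 (i : Fin (m + 1)) (x : E) : ℂ :=
  (2 * profileDeriv m t (‖x‖ ^ 2) + 4 * x i ^ 2 * profileDeriv2 m t (‖x‖ ^ 2) : ℝ)

theorem hasDerivAt_norm_add_smul_single_sq {ν : ℕ} (x : EuclideanSpace ℝ (Fin ν)) (i : Fin ν) :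
    HasDerivAt (fun τ : ℝ => ‖x + τ • EuclideanSpace.single i (1 : ℝ)‖ ^ 2) (2 * x i) 0 := by
  have h : HasDerivAt (fun τ : ℝ => x + τ • EuclideanSpace.single i (1 : ℝ))
      (EuclideanSpace.single i (1 : ℝ)) 0 := by
    simpa using ((hasDerivAt_id (0 : ℝ)).smul_const (EuclideanSpace.single i (1 : ℝ))).const_add x
  refine h.norm_sq.congr_deriv ?_
  simp [EuclideanSpace.inner_single_right]

theorem hasDerivAt_add_smul_single_apply {ν : ℕ} (x : EuclideanSpace ℝ (Fin ν)) (i : Fin ν) :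
    HasDerivAt (fun τ : ℝ => (x + τ • EuclideanSpace.single i (1 : ℝ)) i) 1 0 := by
  simpa using (hasDerivAt_id (0 : ℝ)).const_add (x i)

variable {m t}

theorem hasLineDerivAt_eigenfunction (ht : 0 < t) (i : Fin (m + 1)) (x : E) :
    HasLineDerivAt ℝ (eigenfunction m t) (eigenfunctionDeriv m t i x) x
      (EuclideanSpace.single i 1) := by
  have h := HasDerivAt.comp_of_eq (0 : ℝ) (hasDerivAt_profile (m := m) ht (sq_nonneg ‖x‖))
    (hasDerivAt_norm_add_smul_single_sq x i) (by simp)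
  refine (h.ofReal_comp).congr_deriv ?_
  rw [eigenfunctionDeriv]
  congr 1
  ring

theorem hasLineDerivAt_eigenfunctionDeriv (ht : 0 < t) (i : Fin (m + 1)) (x : E) :
    HasLineDerivAt ℝ (eigenfunctionDeriv m t i) (eigenfunctionDeriv2 m t i x) x
      (EuclideanSpace.single i 1) := by
  have h := HasDerivAt.comp_of_eq (0 : ℝ) (hasDerivAt_profileDeriv (m := m) ht (sq_nonneg ‖x‖))
    (hasDerivAt_norm_add_smul_single_sq x i) (by simp)
  have h2 := ((hasDerivAt_add_smul_single_apply x i).const_mul 2).mul h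
  refine (h2.ofReal_comp).congr_deriv ?_
  rw [eigenfunctionDeriv2]
  congr 1
  simp only [Function.comp_apply, zero_smul, add_zero]
  ring

theorem continuous_comp_norm_sq {F : Type*} [NormedAddCommGroup F] {f : ℝ → ℝ}
    (hf : ContinuousOn f (Set.Ici 0)) : Continuous fun x : F => f (‖x‖ ^ 2) :=
  hf.comp_continuous (by fun_prop) fun x => sq_nonneg ‖x‖

theorem continuous_potential (ht : 0 < t) : Continuous (potential m t) :=
  continuous_comp_norm_sq (continuousOn_potentialProfile ht)

theorem continuous_profile_norm_sq (ht : 0 < t) : Continuous fun x : E => profile m t (‖x‖ ^ 2) :=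
  continuous_comp_norm_sq fun _ hs => (hasDerivAt_profile (m := m) ht hs).continuousAt.continuousWithinAt

theorem continuous_eigenfunction (ht : 0 < t) : Continuous (eigenfunction m t) :=
  Complex.continuous_ofReal.comp (continuous_profile_norm_sq ht)

theorem memLp_eigenfunction (ht : 1 ≤ t) : MemLp (eigenfunction m t) 2 volume := by
  obtain ⟨C, -, h⟩ := exists_abs_profile_le m ht
  refine memLp_two_of_norm_le_decayRate m (continuous_eigenfunction (by linarith)) (C := C)
    fun x => ?_
  rw [eigenfunction, Complex.norm_real, Real.norm_eq_abs]
  exact h _ (norm_nonneg x)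

theorem memLp_potential_mul_eigenfunction (ht : 1 ≤ t) :
    MemLp (fun x => (potential m t x : ℂ) * eigenfunction m t x) 2 volume := by
  obtain ⟨C, -, h⟩ := exists_abs_potentialProfile_mul_profile_le m ht
  have ht0 : 0 < t := by linarith
  refine memLp_two_of_norm_le_decayRate m ((Complex.continuous_ofReal.comp
    (continuous_potential ht0)).mul (continuous_eigenfunction ht0)) (C := C) fun x => ?_
  rw [eigenfunction, ← Complex.ofReal_mul, Complex.norm_real, Real.norm_eq_abs]
  exact h _ (norm_nonneg x)

theorem memLp_eigenfunctionDeriv (ht : 1 ≤ t) (i : Fin (m + 1)) :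
    MemLp (eigenfunctionDeriv m t i) 2 volume := by
  obtain ⟨C, -, h⟩ := exists_abs_mul_profileDeriv_le m ht
  have hc : Continuous fun x : E => profileDeriv m t (‖x‖ ^ 2) :=
    continuous_comp_norm_sq (continuousOn_profileDeriv (by linarith))
  refine memLp_two_of_norm_le_decayRate m (C := 2 * C) ?_ fun x => ?_
  · unfold eigenfunctionDeriv
    fun_prop
  · have hi : |x i| ≤ ‖x‖ := by simpa using PiLp.norm_apply_le x i
    have := h _ (norm_nonneg x)
    rw [abs_mul, abs_of_nonneg (norm_nonneg x)] at this
    rw [eigenfunctionDeriv, Complex.norm_real, Real.norm_eq_abs, abs_mul, abs_mul, abs_two]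
    calc 2 * |x i| * |profileDeriv m t (‖x‖ ^ 2)|
        ≤ 2 * ‖x‖ * |profileDeriv m t (‖x‖ ^ 2)| := by gcongr
      _ ≤ _ := by linarith

theorem memLp_eigenfunctionDeriv2 (ht : 1 ≤ t) (i : Fin (m + 1)) :
    MemLp (eigenfunctionDeriv2 m t i) 2 volume := by
  obtain ⟨C₁, -, h₁⟩ := exists_abs_profileDeriv_le m ht
  obtain ⟨C₂, -, h₂⟩ := exists_abs_mul_profileDeriv2_le m ht
  have hc : Continuous fun x : E => profileDeriv m t (‖x‖ ^ 2) :=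
    continuous_comp_norm_sq (continuousOn_profileDeriv (by linarith))
  have hc2 : Continuous fun x : E => profileDeriv2 m t (‖x‖ ^ 2) :=
    continuous_comp_norm_sq (continuousOn_profileDeriv2 (by linarith))
  refine memLp_two_of_norm_le_decayRate m (C := 2 * C₁ + C₂) ?_ fun x => ?_
  · unfold eigenfunctionDeriv2
    fun_prop
  · have hi : x i ^ 2 ≤ ‖x‖ ^ 2 := by
      rw [← sq_abs]
      gcongr
      simpa using PiLp.norm_apply_le x i
    have e1 := h₁ _ (norm_nonneg x)
    have e2 := h₂ _ (norm_nonneg x)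
    rw [abs_mul, abs_of_nonneg (by positivity : 0 ≤ 4 * ‖x‖ ^ 2)] at e2
    rw [eigenfunctionDeriv2, Complex.norm_real, Real.norm_eq_abs]
    refine (abs_add_le _ _).trans ?_
    rw [abs_mul, abs_mul (4 * x i ^ 2), abs_two, abs_of_nonneg (by positivity : 0 ≤ 4 * x i ^ 2)]
    calc _ ≤ 2 * |profileDeriv m t (‖x‖ ^ 2)| + 4 * ‖x‖ ^ 2 * |profileDeriv2 m t (‖x‖ ^ 2)| := by
          gcongr
      _ ≤ _ := by linarith

theorem sum_eigenfunctionDeriv2 (x : E) :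
    ∑ i, eigenfunctionDeriv2 m t i x =
      (potential m t x : ℂ) * eigenfunction m t x - eigenfunction m t x := by
  have h : ∑ i, x i ^ 2 = ‖x‖ ^ 2 := (EuclideanSpace.real_norm_sq_eq x).symm
  have heq := profile_equation (m := m) (t := t) (‖x‖ ^ 2)
  simp only [eigenfunctionDeriv2, potential, eigenfunction]
  rw [← Complex.ofReal_sum, ← Complex.ofReal_mul, ← Complex.ofReal_sub]
  congr 1
  rw [Finset.sum_add_distrib, Finset.sum_const, ← Finset.sum_mul, ← Finset.mul_sum, h]
  simp only [Finset.card_univ, Fintype.card_fin, nsmul_eq_mul, Nat.cast_add,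
    Nat.cast_one]
  linarith

/-- A continuous function vanishing almost everywhere vanishes everywhere, but the value at the
origin is t⁻². -/
theorem toLp_eigenfunction_ne_zero (ht : 1 ≤ t) :
    ((memLp_eigenfunction (m := m) ht).toLp _ : L2Space (m + 1)) ≠ 0 := by
  intro h
  have h1 : eigenfunction m t =ᵐ[volume] fun _ => 0 :=
    (memLp_eigenfunction (m := m) ht).coeFn_toLp.symm.trans ((Lp.eq_zero_iff_ae_eq_zero).1 h)
  have h2 := (continuous_eigenfunction (m := m) (by linarith : 0 < t)).ae_eq_iff_eq volume
    continuous_const |>.1 h1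
  have h3 := congrFun h2 0
  have ht0 : t ≠ 0 := by linarith
  simp [eigenfunction, profile, besselSeries_zero, damping, ht0] at h3

theorem isEigenvalue_potential (ht : 1 ≤ t) :
    IsEigenvalue (schrodingerOperator fun x => (potential m t x : ℂ)) 1 := by
  have ht0 : 0 < t := by linarith
  set ψ : L2Space (m + 1) := (memLp_eigenfunction (m := m) ht).toLp _ with hψ
  set Vψ : L2Space (m + 1) := (memLp_potential_mul_eigenfunction (m := m) ht).toLp _ with hVψ
  set G : Fin (m + 1) → L2Space (m + 1) := fun i => (memLp_eigenfunctionDeriv ht i).toLp _ with hG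
  set K : Fin (m + 1) → L2Space (m + 1) :=
    fun i => (memLp_eigenfunctionDeriv2 ht i).toLp _ with hK
  have hae : Vψ =ᵐ[volume] fun x => (potential m t x : ℂ) * ψ x := by
    filter_upwards [(memLp_potential_mul_eigenfunction (m := m) ht).coeFn_toLp,
      (memLp_eigenfunction (m := m) ht).coeFn_toLp] with x h1 h2
    rw [h1, h2]
  have hmem := mem_schrodingerGraph_of_hasWeakGradient (G := G) (K := K) hae
    (fun i => lineDerivOp_toLp_of_hasLineDerivAt _ _ _ (hasLineDerivAt_eigenfunction ht0 i))
    (fun i => lineDerivOp_toLp_of_hasLineDerivAt _ _ _ (hasLineDerivAt_eigenfunctionDeriv ht0 i))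
  have hsum : Vψ - ∑ i, K i = ψ := by
    refine Lp.ext ?_
    filter_upwards [Lp.coeFn_sub Vψ (∑ i, K i), Lp.coeFn_finsetSum Finset.univ K,
      (memLp_potential_mul_eigenfunction (m := m) ht).coeFn_toLp,
      (memLp_eigenfunction (m := m) ht).coeFn_toLp,
      ae_all_iff.2 fun i => (memLp_eigenfunctionDeriv2 (m := m) ht i).coeFn_toLp]
      with x h1 h2 h3 h4 h5
    rw [h1, Pi.sub_apply, h2, h3, h4, Finset.sum_apply, Finset.sum_congr rfl fun i _ => h5 i,
      sum_eigenfunctionDeriv2]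
    ring
  rw [hsum, ← graph_schrodingerOperator, LinearPMap.mem_graph_iff] at hmem
  obtain ⟨y, hy1, hy2⟩ := hmem
  refine ⟨y, ?_, ?_⟩
  · rw [hy1]
    exact toLp_eigenfunction_ne_zero ht
  · rw [hy2, one_smul, hy1]

end Eigenfunction

/-! ### Smallness in L^p -/

section LpBounds

theorem isRadial_potential (m : ℕ) (t : ℝ) : IsRadial (potential m t) := fun x y h => by
  simp only [potential, h]

theorem exists_memLp_one_add_norm_rpow {ν : ℕ} {p : ℝ≥0∞} (hp : (ν : ℝ≥0∞) < p) :
    ∃ a : ℝ, 0 ≤ a ∧ a < 1 ∧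
      MemLp (fun x : EuclideanSpace ℝ (Fin ν) => (1 + ‖x‖) ^ (-a)) p volume := by
  rcases eq_or_ne p ∞ with rfl | hp'
  · exact ⟨0, le_rfl, one_pos, by simpa using memLp_top_const (1 : ℝ)⟩
  · have hq : (ν : ℝ) < p.toReal := by
      rw [← ENNReal.toReal_natCast]
      exact (ENNReal.toReal_lt_toReal (ENNReal.natCast_ne_top ν) hp').2 hp
    set q := p.toReal with hqdef
    have hν : (0 : ℝ) ≤ ν := by positivity
    have hq0 : 0 < q := by linarith
    -- With this a, the product a q is the midpoint of ν and q: above ν for integrability, below q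
    -- so that a < 1.
    refine ⟨(ν + q) / (2 * q), by positivity, ?_, ?_⟩
    · rw [div_lt_one (by positivity)]
      linarith
    · have hmeas : Measurable fun x : EuclideanSpace ℝ (Fin ν) =>
          (1 + ‖x‖) ^ (-((ν + q) / (2 * q))) := by fun_prop
      rw [← integrable_norm_rpow_iff hmeas.aestronglyMeasurable (pos_of_gt hp).ne' hp', ← hqdef]
      have hr : (Module.finrank ℝ (EuclideanSpace ℝ (Fin ν)) : ℝ) < (ν + q) / 2 := by
        rw [finrank_euclideanSpace_fin]
        linarith
      refine (integrable_one_add_norm hr).congr (Eventually.of_forall fun x => ?_)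
      have h0 : 0 ≤ 1 + ‖x‖ := by positivity
      simp only
      rw [Real.norm_of_nonneg (by positivity), ← Real.rpow_mul h0]
      congr 1
      field_simp

/-- Splitting t + r into powers 1 - a and a separates a factor tending to 0 in t from a fixed L^p
weight in r. -/
theorem div_add_norm_le {a C t r : ℝ} (ha : 0 ≤ a) (ha1 : a < 1) (hC : 0 ≤ C) (ht : 1 ≤ t)
    (hr : 0 ≤ r) : C / (t + r) ≤ C * t ^ (-(1 - a)) * (1 + r) ^ (-a) := by
  have ht0 : 0 < t := by linarith
  have h : t ^ (1 - a) * (1 + r) ^ a ≤ t + r := by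
    calc t ^ (1 - a) * (1 + r) ^ a ≤ (t + r) ^ (1 - a) * (t + r) ^ a := by
          gcongr
          linarith
      _ = t + r := by
          rw [← Real.rpow_add (by linarith), sub_add_cancel, Real.rpow_one]
  rw [Real.rpow_neg ht0.le, Real.rpow_neg (by linarith), mul_assoc, ← mul_inv, ← div_eq_mul_inv]
  gcongr

/-- Functions bounded by `C / (n + |x|)` tend to zero in `L^p` for `p` above the dimension. -/
theorem memLp_and_tendsto_eLpNorm_of_le_div {ν : ℕ} {V : ℕ → EuclideanSpace ℝ (Fin ν) → ℝ}
    (hmeas : ∀ n, 1 ≤ n → Measurable (V n)) {C : ℝ} (hC : 0 < C)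
    (hV : ∀ n : ℕ, 1 ≤ n → ∀ x, |V n x| ≤ C / (n + ‖x‖)) {p : ℝ≥0∞} (hp : (ν : ℝ≥0∞) < p) :
    (∀ n, 1 ≤ n → MemLp (V n) p volume) ∧
      Tendsto (fun n => eLpNorm (V n) p volume) atTop (𝓝 0) := by
  obtain ⟨a, ha, ha1, hmem⟩ := exists_memLp_one_add_norm_rpow hp
  have hle : ∀ n : ℕ, 1 ≤ n → ∀ x : EuclideanSpace ℝ (Fin ν),
      ‖V n x‖ ≤ C * (n : ℝ) ^ (-(1 - a)) * ‖(1 + ‖x‖) ^ (-a)‖ := fun n hn x => by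
    rw [Real.norm_eq_abs, Real.norm_of_nonneg (by positivity)]
    exact (hV n hn x).trans
      (div_add_norm_le ha ha1 hC.le (by exact_mod_cast hn) (norm_nonneg x))
  refine ⟨fun n hn => hmem.of_le_mul (hmeas n hn).aestronglyMeasurable
    (Eventually.of_forall (hle n hn)), ?_⟩
  have hlim : Tendsto (fun n : ℕ => ENNReal.ofReal (C * (n : ℝ) ^ (-(1 - a))) *
      eLpNorm (fun x : EuclideanSpace ℝ (Fin ν) => (1 + ‖x‖) ^ (-a)) p volume) atTop (𝓝 0) := by
    have h1 : Tendsto (fun n : ℕ => C * (n : ℝ) ^ (-(1 - a))) atTop (𝓝 0) := by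
      simpa using ((tendsto_rpow_neg_atTop (by linarith : 0 < 1 - a)).comp
        tendsto_natCast_atTop_atTop).const_mul C
    have h2 := ENNReal.tendsto_ofReal h1
    simpa using ENNReal.Tendsto.mul_const h2 (Or.inr hmem.eLpNorm_lt_top.ne)
  refine tendsto_of_tendsto_of_tendsto_of_le_of_le' tendsto_const_nhds hlim
    (Eventually.of_forall fun n => zero_le) ?_
  filter_upwards [eventually_ge_atTop 1] with n hn
  exact eLpNorm_le_mul_eLpNorm_of_ae_le_mul (Eventually.of_forall (hle n hn)) p

theorem tendsto_integral_rpow_of_tendsto_eLpNorm {α : Type*} [MeasurableSpace α] {μ : Measure α}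
    {V : ℕ → α → ℝ} {q : ℝ} (hq : 0 < q)
    (hV : ∀ n, 1 ≤ n → MemLp (V n) (ENNReal.ofReal q) μ)
    (h : Tendsto (fun n => eLpNorm (V n) (ENNReal.ofReal q) μ) atTop (𝓝 0)) :
    Tendsto (fun n => ∫ x, |V n x| ^ q ∂μ) atTop (𝓝 0) := by
  have h1 := (ENNReal.tendsto_toReal ENNReal.zero_ne_top).comp h
  have h2 := h1.rpow_const (p := q) (Or.inr hq.le)
  rw [ENNReal.toReal_zero, Real.zero_rpow hq.ne'] at h2
  refine h2.congr' ?_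
  filter_upwards [eventually_ge_atTop 1] with n hn
  have hI : 0 ≤ ∫ x, |V n x| ^ q ∂μ := integral_nonneg fun x => by positivity
  rw [Function.comp_apply, (hV n hn).eLpNorm_eq_integral_rpow_norm
    (ENNReal.ofReal_pos.2 hq).ne' ENNReal.ofReal_ne_top, ENNReal.toReal_ofReal hq.le]
  simp only [Real.norm_eq_abs]
  rw [ENNReal.toReal_ofReal (by positivity), Real.rpow_inv_rpow hI hq.ne']

end LpBounds

/-! ### The sequence V_n and the failure of the eigenvalue bound -/

theorem theorem2p2 (ν : ℕ) (hν : 1 ≤ ν) :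
    (∃ V : ℕ → EuclideanSpace ℝ (Fin ν) → ℝ,
      (∀ n : ℕ, 1 ≤ n → Measurable (V n) ∧ IsRadial (V n) ∧
        IsEigenvalue (schrodingerOperator (fun x => (V n x : ℂ))) 1) ∧
      (∃ C : ℝ, 0 < C ∧ ∀ n : ℕ, 1 ≤ n → ∀ x, |V n x| ≤ C / (n + ‖x‖)) ∧
      (∀ p : ℝ≥0∞, (ν : ℝ≥0∞) < p →
        (∀ n : ℕ, 1 ≤ n → MemLp (V n) p volume) ∧
        Tendsto (fun n => eLpNorm (V n) p volume) atTop (𝓝 0))) ∧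
    (∀ γ : ℝ, (ν : ℝ) / 2 < γ →
      ¬ ∃ C : ℝ, ∀ V : EuclideanSpace ℝ (Fin ν) → ℝ, IsRadial V →
        MemLp V (ENNReal.ofReal (γ + ν / 2)) volume →
        ∀ E : ℝ, 0 < E → IsEigenvalue (schrodingerOperator (fun x => (V x : ℂ))) (E : ℂ) →
          |E| ^ γ ≤ C * ∫ x, |V x| ^ (γ + ν / 2)) := by
  obtain ⟨m, rfl⟩ : ∃ m, ν = m + 1 := ⟨ν - 1, by omega⟩
  have hcast : ∀ n : ℕ, 1 ≤ n → (1 : ℝ) ≤ n := fun n hn => by exact_mod_cast hn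
  have hmeas : ∀ n : ℕ, 1 ≤ n → Measurable (potential m (n : ℝ)) := fun n hn =>
    (continuous_potential (by linarith [hcast n hn])).measurable
  have heig : ∀ n : ℕ, 1 ≤ n →
      IsEigenvalue (schrodingerOperator fun x => (potential m (n : ℝ) x : ℂ)) 1 :=
    fun n hn => isEigenvalue_potential (hcast n hn)
  obtain ⟨C, hC, hbound⟩ := exists_abs_potentialProfile_le m
  have hV : ∀ n : ℕ, 1 ≤ n → ∀ x, |potential m (n : ℝ) x| ≤ C / (n + ‖x‖) := fun n hn x =>
    hbound n (hcast n hn) ‖x‖ (norm_nonneg x)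
  have hLp := fun (p : ℝ≥0∞) (hp : ((m + 1 : ℕ) : ℝ≥0∞) < p) =>
    memLp_and_tendsto_eLpNorm_of_le_div hmeas hC hV hp
  refine ⟨⟨fun n => potential m n, fun n hn => ⟨hmeas n hn, isRadial_potential m n, heig n hn⟩,
    ⟨C, hC, hV⟩, hLp⟩, ?_⟩
  rintro γ hγ ⟨D, hD⟩
  -- The assumption γ > ν / 2 says exactly that q > ν, the range in which the norms tend to 0.
  set q : ℝ := γ + (m + 1 : ℕ) / 2 with hq
  have hν0 : (0 : ℝ) ≤ (m + 1 : ℕ) := by positivity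
  have hq' : ((m + 1 : ℕ) : ℝ) < q := by linarith
  have hp : ((m + 1 : ℕ) : ℝ≥0∞) < ENNReal.ofReal q := by
    rw [← ENNReal.ofReal_natCast]
    exact (ENNReal.ofReal_lt_ofReal_iff (by linarith)).2 hq'
  obtain ⟨hmem, hlim⟩ := hLp _ hp
  have hI := (tendsto_integral_rpow_of_tendsto_eLpNorm (by linarith) hmem hlim).const_mul D
  rw [mul_zero] at hI
  refine absurd (ge_of_tendsto hI (b := 1) ?_) (by norm_num)
  filter_upwards [eventually_ge_atTop 1] with n hn
  have := hD (potential m n) (isRadial_potential m n) (hmem n hn) 1 one_pos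
    (by simpa using heig n hn)
  simpa using this
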